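/- **Setting.** All C*-algebras are unital. Let $\mathcal G$ be a connected graph in the sense of Serre: $V(\mathcal G)$ is the set of vertices, and each edge $e$ has a source $s(e)$, a range $r(e)$ and an inverse edge $\bar e\neq e$ with $\bar{\bar e}=e$ and $s(\bar e)=r(e)$. A *graph of C\*-algebras* over $\mathcal G$ consists of C*-algebras $A_q$ ($q$ a vertex) and $B_e=B_{\bar e}$ ($e$ an edge), and injective unital $*$-homomorphisms $s_e:B_e\to A_{s(e)}$; put $r_e=s_{\bar e}:B_e\to A_{r(e)}$. Suppose that for every edge $e$ a conditional expectation $\mathbb E_e^s:A_{s(e)}\to s_e(B_e)$ is given. A conditional expectation $\mathbb E:A\to D$ is *GNS-faithful* if the only $x\in A$ with $\mathbb E((xy)^*(xy))=0$ for all $y\in A$ is $x=0$. A *path* from $q$ to $p$ is a sequence $w=(e_1,\dots,e_n)$, $n\ge 0$, of composable edges from $q$ to $p$. **Path modules.** A *reduced word* from $q$ to $p$ consists of a path $(e_1,\dots,e_n)$, $n\ge0$, from $q$ to $p$ and elements $a_0\in A_q$, $a_i\in A_{r(e_i)}$ $(1\le i\le n)$ with $\mathbb E^s_{e_{i+1}}(a_i)=0$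 whenever $1\le i\le n-1$ and $e_{i+1}=\bar e_i$. Let $\mathcal H_{q,p}$ be the right Hilbert $A_p$-module obtained by separation and completion of the finite right $A_p$-linear combinations of reduced words $\hat a_0\otimes\cdots\otimes\hat a_{n-1}\otimes a_n$ from $q$ to $p$, where words along different paths are orthogonal, and words $a,b$ along the same path have $\langle a,b\rangle=x_n$ with $x_0=a_0^*b_0$, $x_k=a_k^*\,r_{e_k}s_{e_k}^{-1}\mathbb E^s_{e_k}(x_{k-1})\,b_k$. (Thus $\mathcal H_{q,p}=\bigoplus_w\mathcal K_0\otimes\cdots\otimes\mathcal K_n$, the sum running over the paths $w$ from $q$ to $p$, where $\mathcal K_i$, for $i<n$, is the GNS module of $s_{e_{i+1}}^{-1}\circ\mathbb E_{e_{i+1}}^s$, replaced, if $i\geq 1$ and $e_{i+1}=\bar e_i$, by the closure of the image of $\ker\mathbb E_{e_{i+1}}^s$, and where $\mathcal K_n=A_p$.) The algebra $A_q$ acts on $\mathcal H_{q,p}$ by left multiplication of the first letter. For each edge $e$ let $u_e^p:\mathcal H_{r(e),p}\to\mathcal H_{s(e),p}$ be the unitary that adds $e$ on the left: it sends a word $\xi=\hat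 a_0\otimes\xi'$ to $\hat 1\otimes\xi$ (a word whose path begins with $e$), except that if the first edge of $\xi$ is $\bar e$ and $a_0\in s_{\bar e}(B_e)$ it sends it to $r_{\bar e}s_{\bar e}^{-1}(a_0)\,\xi'$ (for a general $a_0$, split $a_0=(a_0-\mathbb E^s_{\bar e}(a_0))+\mathbb E_{\bar e}^s(a_0)$). Then $(u^p_e)^*=u^p_{\bar e}$. For a path $w=(e_1,\dots,e_n)$ put $u^p_w=u^p_{e_1}\cdots u^p_{e_n}$. For a vertex $p_0$ the *reduced fundamental C\*-algebra* $P(p_0)\subset\mathcal L_{A_{p_0}}(\mathcal H_{p_0,p_0})$ is the C*-algebra generated by all $(u_z^{p_0})^*\,a\,u_w^{p_0}$, where $q$ is a vertex, $a\in A_q$, and $z,w$ are paths from $q$ to $p_0$. An operator $a_0u^{p_0}_{e_1}\cdots u^{p_0}_{e_n}a_n$ given by a reduced word with $n\ge1$ is called a *reduced operator*; those from $p_0$ to $p_0$ lie in $P(p_0)$. **Proposition.** Fix a vertex $p_0$. For every vertex $p$ let $\mathcal K_p$ be a right Hilbert $A_{p_0}$-module with a faithful unital $*$-homomorphism $\pi_p:A_p\to\mathcal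 L_{A_{p_0}}(\mathcal K_p)$, and for every edge $e$ let $w_e\in\mathcal L_{A_{p_0}}(\mathcal K_{r(e)},\mathcal K_{s(e)})$ be a unitary such that $w_e^*=w_{\bar e}$ and $$w_{\bar e}\,\pi_{s(e)}(s_e(b))\,w_e=\pi_{r(e)}(r_e(b))\qquad(b\in B_e).$$ Let $A\subset\mathcal L_{A_{p_0}}(\mathcal K_{p_0})$ be the closed linear span of $\pi_{p_0}(A_{p_0})$ and all operators $\pi_{s(e_1)}(a_0)w_{e_1}\cdots w_{e_n}\pi_{r(e_n)}(a_n)$, where $n\ge1$, $(e_1,\dots,e_n)$ is a path from $p_0$ to $p_0$, $a_0\in A_{p_0}$ and $a_k\in A_{r(e_k)}$; it is a C*-algebra. Suppose that there is a GNS-faithful conditional expectation $\mathbb E:A\to\pi_{p_0}(A_{p_0})$ such that $$\mathbb E\big(\pi_{s(e_1)}(a_0)w_{e_1}\cdots w_{e_n}\pi_{r(e_n)}(a_n)\big)=0$$ for every reduced word from $p_0$ to $p_0$ with $n\ge1$. Then there exists a unique $*$-isomorphism $\pi:P(p_0)\to A$ such that $\pi(a)=\pi_{p_0}(a)$ for every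 $a\in A_{p_0}$ and $$\pi\big(a_0u^{p_0}_{e_1}\cdots u^{p_0}_{e_n}a_n\big)=\pi_{s(e_1)}(a_0)w_{e_1}\cdots w_{e_n}\pi_{r(e_n)}(a_n)$$ for every reduced operator $a_0u^{p_0}_{e_1}\cdots u^{p_0}_{e_n}a_n\in P(p_0)$. -/

import Mathlib

universe u₁ u₂ u₃ u₄

namespace GraphCStar

section Positivity

/-- Positive elements of a C*-algebra, written without reference to a chosen order instance. -/
def IsPos {A : Type*} [Mul A] [Star A] (a : A) : Prop := ∃ b : A, a = star b * b

variable {A : Type*} [CStarAlgebra A]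

theorem IsPos.sum {ι : Type*} (s : Finset ι) (f : ι → A) (h : ∀ i ∈ s, IsPos (f i)) :
    IsPos (∑ i ∈ s, f i) := by
  let _ := CStarAlgebra.spectralOrder A
  let _ := CStarAlgebra.spectralOrderedRing A
  refine CStarAlgebra.nonneg_iff_eq_star_mul_self.mp (Finset.sum_nonneg fun i hi => ?_)
  exact CStarAlgebra.nonneg_iff_eq_star_mul_self.mpr (h i hi)

/-- If `P + R = Q` with positive `P`, `R` then `‖P‖ ≤ ‖Q‖`. -/
theorem IsPos.norm_le {p q : A} (hp : IsPos p) (h : IsPos (q - p)) : ‖p‖ ≤ ‖q‖ := by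
  let _ := CStarAlgebra.spectralOrder A
  let _ := CStarAlgebra.spectralOrderedRing A
  refine CStarAlgebra.norm_le_norm_of_nonneg_of_le
    (CStarAlgebra.nonneg_iff_eq_star_mul_self.mpr hp) ?_
  exact sub_nonneg.mp (CStarAlgebra.nonneg_iff_eq_star_mul_self.mpr h)

theorem IsPos.add {a b : A} (ha : IsPos a) (hb : IsPos b) : IsPos (a + b) := by
  have := IsPos.sum (Finset.univ : Finset (Fin 2)) ![a, b] (by intro i _; fin_cases i <;> assumption)
  simpa using this

theorem IsPos.norm_smul_sub {a b : A} (ha : IsPos a) :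
    IsPos ((‖a‖ : ℝ) • (star b * b) - star b * a * b) := by
  let _ := CStarAlgebra.spectralOrder A
  let _ := CStarAlgebra.spectralOrderedRing A
  refine CStarAlgebra.nonneg_iff_eq_star_mul_self.mp (sub_nonneg.mpr ?_)
  have h0 : 0 ≤ a := CStarAlgebra.nonneg_iff_eq_star_mul_self.mpr ha
  exact CStarAlgebra.star_left_conjugate_le_norm_smul (IsSelfAdjoint.of_nonneg h0)

theorem IsPos.norm_sq_sub (a : A) : ∃ b : A, star b * b = ((‖a‖ ^ 2 : ℝ) : ℂ) • (1 : A) - star a * a := by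
  have h : IsPos (star a * a) := ⟨a, rfl⟩
  obtain ⟨b, hb⟩ := h.norm_smul_sub (b := (1 : A))
  refine ⟨b, ?_⟩
  rw [← hb, CStarRing.norm_star_mul_self, ← sq]
  simp [← Complex.coe_smul]

theorem exists_negative_part (T : A) (hT : IsSelfAdjoint T) :
    ∃ N R : A, N = star R * R ∧ T * N = -(N * N) ∧ (N = 0 → IsPos T) := by
  let _ := CStarAlgebra.spectralOrder A
  let _ := CStarAlgebra.spectralOrderedRing A
  obtain ⟨R, hR⟩ := CStarAlgebra.nonneg_iff_eq_star_mul_self.mp (CFC.negPart_nonneg T)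
  refine ⟨T⁻, R, hR, ?_, fun h => ?_⟩
  · conv_lhs => enter [1]; rw [← CFC.posPart_sub_negPart T hT]
    rw [sub_mul, CFC.posPart_mul_negPart, zero_sub]
  · refine CStarAlgebra.nonneg_iff_eq_star_mul_self.mp ?_
    rw [← CFC.posPart_sub_negPart T hT, h, sub_zero]
    exact CFC.posPart_nonneg T

/-- A selfadjoint matrix over a C*-algebra whose quadratic form takes positive values is of the form
`k* k`. -/
theorem exists_factor {n : Type*} [Fintype n] [DecidableEq n] (M : n → n → A)
    (hM : ∀ i j, star (M i j) = M j i)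
    (hpos : ∀ b : n → A, IsPos (∑ i, ∑ j, star (b i) * M i j * b j)) :
    ∃ k : n → n → A, ∀ i j, M i j = ∑ l, star (k l i) * k l j := by
  let _ := CStarAlgebra.spectralOrder A
  let _ := CStarAlgebra.spectralOrderedRing A
  let T : CStarMatrix n n A := CStarMatrix.ofMatrix (Matrix.of M)
  have hTs : IsSelfAdjoint T := by
    ext i j
    exact hM j i
  have entry : ∀ (X Y : CStarMatrix n n A) i j, (X * Y) i j = ∑ l, X i l * Y l j := fun X Y i j => by
    exact Matrix.mul_apply
  have sentry : ∀ (X : CStarMatrix n n A) i j, (star X) i j = star (X j i) := fun X i j => rfl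
  obtain ⟨N, R, hR, hTN, hN⟩ := exists_negative_part T hTs
  have hNs : star N = N := by rw [hR]; simp
  suffices h : N = 0 by
    obtain ⟨K, hK⟩ := hN h
    refine ⟨fun i j => K i j, fun i j => ?_⟩
    have : T i j = (star K * K) i j := by rw [← hK]
    rw [entry] at this
    exact this
  have hNTN : N * T * N = - (star (R * N) * (R * N)) := by
    rw [mul_assoc, hTN, star_mul, hNs]
    rw [mul_assoc, ← mul_assoc (star R), ← hR, mul_neg]
  have hRN : R * N = 0 := by
    have hd : ∀ i j, (R * N) i j = 0 := by
      intro i j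
      have h1 : 0 ≤ (N * T * N) j j := by
        rw [CStarAlgebra.nonneg_iff_eq_star_mul_self]
        obtain ⟨c, hc⟩ := hpos (fun i => N i j)
        refine ⟨c, ?_⟩
        rw [← hc, entry, Finset.sum_comm]
        refine Finset.sum_congr rfl fun l _ => ?_
        rw [entry, Finset.sum_mul]
        refine Finset.sum_congr rfl fun m _ => ?_
        have e : N j m = star (N m j) := by rw [← sentry, hNs]
        rw [e]
        rfl
      rw [hNTN] at h1
      have h2 : (star (R * N) * (R * N)) j j ≤ 0 := by
        have : (-(star (R * N) * (R * N))) j j = - ((star (R * N) * (R * N)) j j) := rfl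
        rw [this] at h1
        simpa using h1
      rw [entry] at h2
      have h3 : ∀ l ∈ Finset.univ, 0 ≤ (star (R * N)) j l * (R * N) l j := fun l _ => by
        rw [sentry]; exact star_mul_self_nonneg _
      have h4 := (Finset.sum_eq_zero_iff_of_nonneg h3).mp (le_antisymm h2 (Finset.sum_nonneg h3)) i
        (Finset.mem_univ _)
      rw [sentry] at h4
      exact CStarRing.star_mul_self_eq_zero_iff _ |>.mp h4
    ext i j
    exact hd i j
  have : star N * N = 0 := by
    rw [hNs]
    conv_lhs => enter [1]; rw [hR]
    rw [mul_assoc, hRN, mul_zero]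
  exact CStarRing.star_mul_self_eq_zero_iff _ |>.mp this

end Positivity

section Modules

open MulOpposite

/-- A right module over the C*-algebra `A` with an `A`-valued semi-inner product, linear in the
second variable. (Mathlib's `CStarModule` has the scalars act on the left and pulls them out on the
left, whereas here `⟨x, y·a⟩ = ⟨x, y⟩ a`.) -/
class SemiHilbertModule (A X : Type*) [CStarAlgebra A] [AddCommGroup X] [Module ℂ X]
    [Module Aᵐᵒᵖ X] extends Inner A X where
  ip_add_right (x y z : X) : inner x (y + z) = inner x y + inner x z
  ip_smul_right (c : ℂ) (x y : X) : inner x (c • y) = c • inner x y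
  ip_op_smul_right (a : A) (x y : X) : inner x (op a • y) = inner x y * a
  star_ip (x y : X) : star (inner x y) = inner y x
  ip_self_pos (x : X) : IsPos (inner x x)

/-- A right Hilbert `A`-module. -/
class HilbertModule (A E : Type*) [CStarAlgebra A] [NormedAddCommGroup E] [NormedSpace ℂ E]
    [Module Aᵐᵒᵖ E] extends SemiHilbertModule A E where
  norm_sq (x : E) : ‖x‖ ^ 2 = ‖inner x x‖
  complete : CompleteSpace E

/-- The seminorm of `X` is the one given by its semi-inner product. -/
class InnerNorm (A X : Type*) [CStarAlgebra A] [SeminormedAddCommGroup X] [NormedSpace ℂ X]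
    [Module Aᵐᵒᵖ X] [SemiHilbertModule A X] : Prop where
  norm_sq (x : X) : ‖x‖ ^ 2 = ‖inner A x x‖

instance (A E : Type*) [CStarAlgebra A] [NormedAddCommGroup E] [NormedSpace ℂ E]
    [Module Aᵐᵒᵖ E] [HilbertModule A E] : InnerNorm A E := ⟨HilbertModule.norm_sq⟩

namespace SemiHilbertModule

section algebraic

variable {A X : Type*} [CStarAlgebra A] [AddCommGroup X] [Module ℂ X]
  [Module Aᵐᵒᵖ X] [SemiHilbertModule A X]

theorem ip_add_left (x y z : X) : inner A (x + y) z = inner A x z + inner A y z := by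
  rw [← star_ip, ip_add_right, star_add, star_ip, star_ip]

theorem ip_smul_left (c : ℂ) (x y : X) : inner A (c • x) y = star c • inner A x y := by
  rw [← star_ip, ip_smul_right, star_smul, star_ip]

theorem ip_op_smul_left (a : A) (x y : X) : inner A (op a • x) y = star a * inner A x y := by
  rw [← star_ip, ip_op_smul_right, star_mul, star_ip]

/-- The semi-inner product as a sesquilinear map. -/
noncomputable def ipₛₗ : X →ₗ⋆[ℂ] X →ₗ[ℂ] A :=
  LinearMap.mk₂'ₛₗ (starRingEnd ℂ) (RingHom.id ℂ) (fun x y => inner A x y) ip_add_left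
    ip_smul_left ip_add_right ip_smul_right

theorem ipₛₗ_apply (x y : X) : ipₛₗ x y = inner A x y := rfl

theorem ip_sub_right (x y z : X) : inner A x (y - z) = inner A x y - inner A x z := by
  simp only [← ipₛₗ_apply, map_sub]

theorem ip_sub_left (x y z : X) : inner A (x - y) z = inner A x z - inner A y z := by
  simp only [← ipₛₗ_apply, map_sub, LinearMap.sub_apply]

theorem ip_zero_right (x : X) : inner A x (0 : X) = 0 := by
  simp only [← ipₛₗ_apply, map_zero]

theorem ip_zero_left (x : X) : inner A (0 : X) x = 0 := by
  simp only [← ipₛₗ_apply, map_zero, LinearMap.zero_apply]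

theorem norm_ip_sq_le (x y : X) :
    ‖inner A x y‖ ^ 2 ≤ ‖inner A x x‖ * ‖inner A y y‖ := by
  have key : ∀ ε : ℝ, 0 < ε → ‖inner A x y‖ ^ 2 ≤ (‖inner A x x‖ + ε) * ‖inner A y y‖ := by
    intro ε hε
    set s : ℝ := ‖inner A x x‖ + ε with hs
    have hs0 : 0 < s := by positivity
    set c := inner A x y with hc
    have hyx : inner A y x = star c := (star_ip x y).symm
    have h1 : IsPos (inner A (op c • x - (s : ℂ) • y) (op c • x - (s : ℂ) • y)) := ip_self_pos _
    have e1 : inner A (op c • x - (s : ℂ) • y) (op c • x - (s : ℂ) • y) =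
        star c * inner A x x * c - (2 * s : ℂ) • (star c * c) + (s ^ 2 : ℂ) • inner A y y := by
      simp only [ip_sub_left, ip_sub_right, ip_op_smul_left, ip_op_smul_right,
        ip_smul_left, ip_smul_right, hyx, ← hc]
      simp only [RCLike.star_def, Complex.conj_ofReal, sub_mul, smul_mul_assoc, mul_assoc]
      module
    have h2 := (ip_self_pos (A := A) x).norm_smul_sub (b := c)
    have h3 := h1.add h2
    have h4 : IsPos (star (((Real.sqrt ε : ℝ) : ℂ) • c) * (((Real.sqrt ε : ℝ) : ℂ) • c)) := ⟨_, rfl⟩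
    have e4 : star (((Real.sqrt ε : ℝ) : ℂ) • c) * (((Real.sqrt ε : ℝ) : ℂ) • c)
        = (ε : ℂ) • (star c * c) := by
      rw [star_smul, smul_mul_smul_comm, RCLike.star_def, Complex.conj_ofReal, ← Complex.ofReal_mul,
        Real.mul_self_sqrt hε.le]
    rw [e4] at h4
    have h5 := h3.add h4
    have h6 : IsPos ((s : ℂ) • (star c * c)) := by
      refine ⟨((Real.sqrt s : ℝ) : ℂ) • c, ?_⟩
      rw [star_smul, smul_mul_smul_comm, RCLike.star_def, Complex.conj_ofReal, ← Complex.ofReal_mul,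
        Real.mul_self_sqrt hs0.le]
    have h7 : IsPos ((s ^ 2 : ℂ) • inner A y y - (s : ℂ) • (star c * c)) := by
      convert h5 using 1
      rw [e1, ← Complex.coe_smul]
      have : (‖inner A x x‖ : ℂ) = s - ε := by rw [hs]; push_cast; ring
      rw [this]
      module
    have h8 := h6.norm_le h7
    rw [norm_smul, norm_smul, CStarRing.norm_star_mul_self] at h8
    simp only [norm_pow, Complex.norm_real, Real.norm_eq_abs, abs_of_pos hs0] at h8
    nlinarith
  refine le_of_forall_pos_le_add fun δ hδ => ?_
  have := key (δ / (‖inner A y y‖ + 1)) (by positivity)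
  refine this.trans ?_
  rw [add_mul]
  gcongr
  rw [div_mul_eq_mul_div, div_le_iff₀ (by positivity)]
  nlinarith [norm_nonneg (inner A y y)]

/-- The seminorm `‖x‖ = ‖⟨x, x⟩‖^(1/2)`. -/
noncomputable abbrev toNorm (A X : Type*) [CStarAlgebra A] [AddCommGroup X] [Module ℂ X]
    [Module Aᵐᵒᵖ X] [SemiHilbertModule A X] : Norm X := ⟨fun x => √‖inner A x x‖⟩

theorem core (A X : Type*) [CStarAlgebra A] [AddCommGroup X] [Module ℂ X]
    [Module Aᵐᵒᵖ X] [SemiHilbertModule A X] :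
    letI := toNorm A X
    SeminormedSpace.Core ℂ X :=
  letI := toNorm A X
  { norm_nonneg := fun x => Real.sqrt_nonneg _
    norm_smul := fun c x => by
      change √‖inner A (c • x) (c • x)‖ = ‖c‖ * √‖inner A x x‖
      rw [ip_smul_left, ip_smul_right, norm_smul, norm_smul, norm_star, ← mul_assoc,
        Real.sqrt_mul (by positivity), Real.sqrt_mul_self (norm_nonneg c)]
    norm_triangle := fun x y => by
      change √‖inner A (x + y) (x + y)‖ ≤ √‖inner A x x‖ + √‖inner A y y‖
      have cs : ∀ u v : X, ‖inner A u v‖ ≤ √‖inner A u u‖ * √‖inner A v v‖ := fun u v => by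
        rw [← Real.sqrt_mul (norm_nonneg _)]
        exact Real.le_sqrt_of_sq_le (norm_ip_sq_le u v)
      rw [Real.sqrt_le_left (by positivity)]
      have hx := Real.mul_self_sqrt (norm_nonneg (inner A x x))
      have hy := Real.mul_self_sqrt (norm_nonneg (inner A y y))
      calc ‖inner A (x + y) (x + y)‖
          = ‖(inner A x x + inner A y x) + (inner A x y + inner A y y)‖ := by
            rw [ip_add_right, ip_add_left, ip_add_left]
        _ ≤ (‖inner A x x‖ + ‖inner A y x‖) + (‖inner A x y‖ + ‖inner A y y‖) :=
            (norm_add_le _ _).trans (add_le_add (norm_add_le _ _) (norm_add_le _ _))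
        _ ≤ _ := by nlinarith [cs x y, cs y x] }

end algebraic

section normed

variable {A X : Type*} [CStarAlgebra A] [SeminormedAddCommGroup X] [NormedSpace ℂ X]
  [Module Aᵐᵒᵖ X] [SemiHilbertModule A X] [InnerNorm A X]

theorem norm_ip_le (x y : X) : ‖inner A x y‖ ≤ ‖x‖ * ‖y‖ := by
  have h := norm_ip_sq_le (A := A) x y
  rw [← InnerNorm.norm_sq, ← InnerNorm.norm_sq, ← mul_pow] at h
  exact (pow_le_pow_iff_left₀ (norm_nonneg _) (by positivity) two_ne_zero).mp h

/-- The semi-inner product as a continuous sesquilinear map. -/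
noncomputable def ipSL : X →L⋆[ℂ] X →L[ℂ] A :=
  LinearMap.mkContinuous₂ ipₛₗ 1 fun x y => by
    rw [one_mul]; exact norm_ip_le x y

theorem ipSL_apply (x y : X) : ipSL x y = inner A x y := rfl

theorem continuous_ip : Continuous fun p : X × X => inner A p.1 p.2 := by
  simp_rw [← ipSL_apply]
  fun_prop

theorem norm_op_smul_le (a : A) (x : X) : ‖op a • x‖ ≤ ‖a‖ * ‖x‖ := by
  refine (pow_le_pow_iff_left₀ (norm_nonneg _) (by positivity) two_ne_zero).mp ?_
  rw [InnerNorm.norm_sq (A := A), ip_op_smul_left, ip_op_smul_right, mul_pow,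
    InnerNorm.norm_sq (A := A) x]
  calc _ ≤ ‖star a‖ * (‖inner A x x‖ * ‖a‖) :=
        (norm_mul_le _ _).trans (mul_le_mul_of_nonneg_left (norm_mul_le _ _) (norm_nonneg _))
    _ = _ := by rw [norm_star]; ring

variable (A X) in
theorem uniformContinuousConstSMul : UniformContinuousConstSMul Aᵐᵒᵖ X := by
  constructor
  intro a
  refine LipschitzWith.uniformContinuous (K := ‖a.unop‖₊) ?_
  refine LipschitzWith.of_dist_le_mul fun x y => ?_
  rw [dist_eq_norm, dist_eq_norm, ← smul_sub]
  exact norm_op_smul_le a.unop _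

end normed

end SemiHilbertModule

/-! ### Completion -/

section Completion

open UniformSpace UniformSpace.Completion SemiHilbertModule Function

variable {A X : Type*} [CStarAlgebra A] [SeminormedAddCommGroup X] [NormedSpace ℂ X]
  [Module Aᵐᵒᵖ X] [SemiHilbertModule A X] [InnerNorm A X]

theorem completion_inner_coe (x y : X) :
    inner A (x : Completion X) (y : Completion X) = inner A x y :=
  (isDenseInducing_coe.prodMap isDenseInducing_coe).extend_eq
    (continuous_ip : Continuous (uncurry (inner A (E := X)))) (x, y)

theorem completion_continuous_ip :
    Continuous (uncurry (inner A (E := Completion X))) := by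
  let inner' : X →+ X →+ A :=
    { toFun := fun x => (ipₛₗ x).toAddMonoidHom
      map_zero' := by ext x; exact ip_zero_left _
      map_add' := fun x y => by ext z; exact ip_add_left _ _ _ }
  have : Continuous fun p : X × X => inner' p.1 p.2 := continuous_ip
  rw [Completion.toInner, inner, uncurry_curry _]
  change
    Continuous
      (((isDenseInducing_toCompl X).prodMap (isDenseInducing_toCompl X)).extend fun p : X × X =>
        inner' p.1 p.2)
  exact (isDenseInducing_toCompl X).extend_Z_bilin (isDenseInducing_toCompl X) this

theorem completion_continuous_ip' {α : Type*} [TopologicalSpace α] {f g : α → Completion X}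
    (hf : Continuous f) (hg : Continuous g) : Continuous (fun x : α => inner A (f x) (g x)) :=
  completion_continuous_ip.comp (hf.prodMk hg :)

theorem isClosed_isPos (A : Type*) [CStarAlgebra A] : IsClosed {a : A | IsPos a} := by
  let _ := CStarAlgebra.spectralOrder A
  let _ := CStarAlgebra.spectralOrderedRing A
  have : {a : A | IsPos a} = {a | 0 ≤ a} := by
    ext a
    exact CStarAlgebra.nonneg_iff_eq_star_mul_self.symm
  rw [this]
  exact CStarAlgebra.isClosed_nonneg

variable [UniformContinuousConstSMul Aᵐᵒᵖ X]

noncomputable instance completionSemiHilbertModule : SemiHilbertModule A (Completion X) where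
  toInner := Completion.toInner
  ip_add_right x y z := by
    refine Completion.induction_on₃ x y z (isClosed_eq ?_ ?_) fun a b c => ?_
    · exact completion_continuous_ip' (by fun_prop) (by fun_prop)
    · exact (completion_continuous_ip' (by fun_prop) (by fun_prop)).add
        (completion_continuous_ip' (by fun_prop) (by fun_prop))
    · simp only [← coe_add, completion_inner_coe, ip_add_right]
  ip_smul_right c x y := by
    refine Completion.induction_on₂ x y (isClosed_eq ?_ ?_) fun a b => ?_
    · exact completion_continuous_ip' continuous_fst
        ((continuous_const_smul c).comp continuous_snd)
    · exact (continuous_const_smul c).comp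
        (completion_continuous_ip' continuous_fst continuous_snd)
    · rw [← coe_smul, completion_inner_coe, completion_inner_coe, ip_smul_right]
  ip_op_smul_right a x y := by
    refine Completion.induction_on₂ x y (isClosed_eq ?_ ?_) fun b c => ?_
    · exact completion_continuous_ip' continuous_fst
        ((continuous_const_smul (op a)).comp continuous_snd)
    · exact (completion_continuous_ip' continuous_fst continuous_snd).mul continuous_const
    · rw [← coe_smul, completion_inner_coe, completion_inner_coe, ip_op_smul_right]
  star_ip x y := by
    refine Completion.induction_on₂ x y (isClosed_eq ?_ ?_) fun b c => ?_
    · exact continuous_star.comp (completion_continuous_ip' continuous_fst continuous_snd)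
    · exact completion_continuous_ip' continuous_snd continuous_fst
    · rw [completion_inner_coe, completion_inner_coe, star_ip]
  ip_self_pos x := by
    refine Completion.induction_on x ?_ fun b => ?_
    · exact (isClosed_isPos A).preimage (completion_continuous_ip' continuous_id continuous_id)
    · rw [completion_inner_coe]; exact ip_self_pos b

/-- The separated completion of a module with a semi-inner product is a Hilbert module. -/
noncomputable instance completionHilbertModule : HilbertModule A (Completion X) where
  norm_sq x := by
    refine Completion.induction_on x (isClosed_eq ?_ ?_) fun b => ?_
    · fun_prop
    · exact (completion_continuous_ip' continuous_id continuous_id).norm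
    · rw [norm_coe, completion_inner_coe, InnerNorm.norm_sq (A := A)]
  complete := inferInstance

end Completion

/-! ### Adjointable operators -/

/-- Bounded adjointable operators between Hilbert `A`-modules (the adjoint is unique, and
`A`-linearity is automatic). -/
structure Adjointable (A E F : Type*) [CStarAlgebra A]
    [NormedAddCommGroup E] [NormedSpace ℂ E] [Module Aᵐᵒᵖ E] [HilbertModule A E]
    [NormedAddCommGroup F] [NormedSpace ℂ F] [Module Aᵐᵒᵖ F] [HilbertModule A F] where
  toCLM : E →L[ℂ] F
  adjCLM : F →L[ℂ] E
  inner_left (x : E) (y : F) : inner A (toCLM x) y = inner A x (adjCLM y)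

namespace Adjointable

open SemiHilbertModule

variable {A E F G : Type*} [CStarAlgebra A]
    [NormedAddCommGroup E] [NormedSpace ℂ E] [Module Aᵐᵒᵖ E] [HilbertModule A E]
    [NormedAddCommGroup F] [NormedSpace ℂ F] [Module Aᵐᵒᵖ F] [HilbertModule A F]
    [NormedAddCommGroup G] [NormedSpace ℂ G] [Module Aᵐᵒᵖ G] [HilbertModule A G]

theorem eq_of_inner {x y : E} (h : ∀ z, inner A z x = inner A z y) : x = y := by
  rw [← sub_eq_zero, ← norm_eq_zero, ← sq_eq_zero_iff, HilbertModule.norm_sq (A := A),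
    ip_sub_right, h, sub_self, norm_zero]

theorem inner_right (T : Adjointable A E F) (x : F) (y : E) :
    inner A x (T.toCLM y) = inner A (T.adjCLM x) y := by
  rw [← star_ip, T.inner_left, star_ip]

@[ext]
theorem ext {S T : Adjointable A E F} (h : ∀ x, S.toCLM x = T.toCLM x) : S = T := by
  obtain ⟨S, S', hS⟩ := S
  obtain ⟨T, T', hT⟩ := T
  obtain rfl : S = T := ContinuousLinearMap.ext h
  have : S' = T' := by
    ext y
    refine eq_of_inner (A := A) fun z => ?_
    rw [← hS, hT]
  subst this
  rfl

/-- Composition of adjointable operators. -/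
def comp (S : Adjointable A F G) (T : Adjointable A E F) : Adjointable A E G where
  toCLM := S.toCLM.comp T.toCLM
  adjCLM := T.adjCLM.comp S.adjCLM
  inner_left x y := by
    simp only [ContinuousLinearMap.comp_apply, S.inner_left, T.inner_left]

/-- The adjoint. -/
def adj (T : Adjointable A E F) : Adjointable A F E where
  toCLM := T.adjCLM
  adjCLM := T.toCLM
  inner_left x y := (T.inner_right x y).symm

@[simp] theorem comp_apply (S : Adjointable A F G) (T : Adjointable A E F) (x : E) :
    (S.comp T).toCLM x = S.toCLM (T.toCLM x) := rfl

variable (A E) in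
/-- The identity operator. -/
protected def id : Adjointable A E E where
  toCLM := ContinuousLinearMap.id ℂ E
  adjCLM := ContinuousLinearMap.id ℂ E
  inner_left _ _ := rfl

@[simp] theorem id_apply (x : E) : (Adjointable.id A E).toCLM x = x := rfl

theorem id_comp (T : Adjointable A E F) : (Adjointable.id A F).comp T = T := rfl

theorem comp_assoc {G' : Type*} [NormedAddCommGroup G'] [NormedSpace ℂ G'] [Module Aᵐᵒᵖ G']
    [HilbertModule A G'] (R : Adjointable A G G') (S : Adjointable A F G) (T : Adjointable A E F) :
    (R.comp S).comp T = R.comp (S.comp T) := rfl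

theorem adj_comp (S : Adjointable A F G) (T : Adjointable A E F) :
    (S.comp T).adj = T.adj.comp S.adj := rfl

/-! The C*-algebra of adjointable operators on a Hilbert module. -/

instance : Zero (Adjointable A E E) :=
  ⟨⟨0, 0, fun x y => by simp [ip_zero_left, ip_zero_right]⟩⟩
instance : One (Adjointable A E E) := ⟨Adjointable.id A E⟩
instance : Mul (Adjointable A E E) := ⟨comp⟩
instance : Star (Adjointable A E E) := ⟨adj⟩
instance : Add (Adjointable A E E) :=
  ⟨fun S T => ⟨S.toCLM + T.toCLM, S.adjCLM + T.adjCLM, fun x y => by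
    simp [ip_add_left, ip_add_right, S.inner_left, T.inner_left]⟩⟩
instance : Neg (Adjointable A E E) :=
  ⟨fun S => ⟨-S.toCLM, -S.adjCLM, fun x y => by
    simp only [neg_apply, ← ipₛₗ_apply (A := A), map_neg,
      LinearMap.neg_apply]
    simp only [ipₛₗ_apply, S.inner_left]⟩⟩
instance : Sub (Adjointable A E E) :=
  ⟨fun S T => ⟨S.toCLM - T.toCLM, S.adjCLM - T.adjCLM, fun x y => by
    simp [ip_sub_left, ip_sub_right, S.inner_left, T.inner_left]⟩⟩
instance : SMul ℂ (Adjointable A E E) :=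
  ⟨fun c S => ⟨c • S.toCLM, star c • S.adjCLM, fun x y => by
    simp [ip_smul_left, ip_smul_right, S.inner_left]⟩⟩
instance : SMul ℕ (Adjointable A E E) :=
  ⟨fun n S => ⟨n • S.toCLM, n • S.adjCLM, fun x y => by
    simp only [smul_apply, ← ipₛₗ_apply (A := A), map_nsmul,
      LinearMap.smul_apply]
    simp only [ipₛₗ_apply, S.inner_left]⟩⟩
instance : SMul ℤ (Adjointable A E E) :=
  ⟨fun n S => ⟨n • S.toCLM, n • S.adjCLM, fun x y => by
    simp only [smul_apply, ← ipₛₗ_apply (A := A), map_zsmul,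
      LinearMap.smul_apply]
    simp only [ipₛₗ_apply, S.inner_left]⟩⟩
instance : Pow (Adjointable A E E) ℕ := ⟨fun S n => npowRec n S⟩
instance : NatCast (Adjointable A E E) := ⟨fun n => n • 1⟩
instance : IntCast (Adjointable A E E) := ⟨fun n => n • 1⟩

theorem toCLM_injective :
    Function.Injective (toCLM : Adjointable A E E → (E →L[ℂ] E)) := fun S T h => by
  ext x; rw [h]

instance : Ring (Adjointable A E E) :=
  toCLM_injective.ring toCLM rfl rfl (fun _ _ => rfl) (fun _ _ => rfl) (fun _ => rfl)
    (fun _ _ => rfl) (fun _ _ => rfl) (fun _ _ => rfl)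
    (fun S n => by
      induction n with
      | zero => rfl
      | succ n ih => rw [pow_succ, ← ih]; rfl)
    (fun n => by
      change n • (1 : E →L[ℂ] E) = _
      simp)
    (fun n => by
      change n • (1 : E →L[ℂ] E) = _
      simp)

instance : Module ℂ (Adjointable A E E) :=
  toCLM_injective.module ℂ
    { toFun := toCLM, map_zero' := rfl, map_add' := fun _ _ => rfl } fun _ _ => rfl

instance : Algebra ℂ (Adjointable A E E) :=
  Algebra.ofModule (fun r S T => by ext x; rfl) fun r S T => by
    ext x
    exact map_smul S.toCLM r (T.toCLM x)

instance : StarRing (Adjointable A E E) where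
  star_involutive _ := rfl
  star_mul _ _ := rfl
  star_add _ _ := rfl

instance : StarModule ℂ (Adjointable A E E) where
  star_smul c S := by ext x; rfl

@[simp] theorem mul_apply (S T : Adjointable A E E) (x : E) :
    (S * T).toCLM x = S.toCLM (T.toCLM x) := rfl

theorem star_def (S : Adjointable A E E) : star S = S.adj := rfl
/-- `toCLM` as a ring homomorphism. -/
def toCLMHom : Adjointable A E E →+* (E →L[ℂ] E) where
  toFun := toCLM
  map_one' := rfl
  map_mul' _ _ := rfl
  map_zero' := rfl
  map_add' _ _ := rfl

noncomputable instance : NormedRing (Adjointable A E E) :=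
  NormedRing.induced _ _ (toCLMHom (A := A) (E := E)) toCLM_injective

theorem norm_def (S : Adjointable A E E) : ‖S‖ = ‖S.toCLM‖ := rfl

noncomputable instance : NormedAlgebra ℂ (Adjointable A E E) where
  norm_smul_le c S := by
    change ‖c • S.toCLM‖ ≤ ‖c‖ * ‖S.toCLM‖
    exact norm_smul_le c S.toCLM

theorem norm_sq_le (S : Adjointable A E E) : ‖S‖ * ‖S‖ ≤ ‖star S * S‖ := by
  have h : ‖S.toCLM‖ ≤ √‖star S * S‖ := by
    refine ContinuousLinearMap.opNorm_le_bound _ (Real.sqrt_nonneg _) fun x => ?_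
    refine (pow_le_pow_iff_left₀ (norm_nonneg _) (by positivity) two_ne_zero).mp ?_
    rw [HilbertModule.norm_sq (A := A), S.inner_left, mul_pow, Real.sq_sqrt (norm_nonneg _)]
    calc ‖inner A x (S.adjCLM (S.toCLM x))‖ ≤ ‖x‖ * ‖(star S * S).toCLM x‖ := norm_ip_le _ _
      _ ≤ ‖x‖ * (‖star S * S‖ * ‖x‖) :=
        mul_le_mul_of_nonneg_left ((star S * S).toCLM.le_opNorm x) (norm_nonneg _)
      _ = _ := by ring
  calc ‖S‖ * ‖S‖ ≤ √‖star S * S‖ * √‖star S * S‖ :=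
        mul_le_mul h h (norm_nonneg _) (Real.sqrt_nonneg _)
    _ = _ := Real.mul_self_sqrt (norm_nonneg _)

instance : CStarRing (Adjointable A E E) := ⟨norm_sq_le⟩

instance : CompleteSpace (Adjointable A E E) := by
  have : CompleteSpace E := HilbertModule.complete A
  refine Metric.complete_of_cauchySeq_tendsto fun u hu => ?_
  have h1 : CauchySeq fun n => (u n).toCLM := by
    rw [Metric.cauchySeq_iff'] at hu ⊢
    exact hu
  have h2 : CauchySeq fun n => (u n).adjCLM := by
    rw [Metric.cauchySeq_iff'] at hu ⊢
    intro ε hε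
    obtain ⟨N, hN⟩ := hu ε hε
    refine ⟨N, fun n hn => ?_⟩
    have := hN n hn
    rw [dist_eq_norm, ← norm_star, norm_def] at this
    rw [dist_eq_norm]
    exact this
  obtain ⟨S, hS⟩ := cauchySeq_tendsto_of_complete h1
  obtain ⟨T, hT⟩ := cauchySeq_tendsto_of_complete h2
  refine ⟨⟨S, T, fun x y => ?_⟩, ?_⟩
  · have hSx : Filter.Tendsto (fun n => (u n).toCLM x) Filter.atTop (nhds (S x)) :=
      ((ContinuousLinearMap.apply ℂ E x).continuous.tendsto S).comp hS
    have hTy : Filter.Tendsto (fun n => (u n).adjCLM y) Filter.atTop (nhds (T y)) :=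
      ((ContinuousLinearMap.apply ℂ E y).continuous.tendsto T).comp hT
    have a1 := ((continuous_ip (A := A) (X := E)).tendsto (S x, y)).comp
      (hSx.prodMk_nhds tendsto_const_nhds)
    have a2 := ((continuous_ip (A := A) (X := E)).tendsto (x, T y)).comp
      ((tendsto_const_nhds (x := x)).prodMk_nhds hTy)
    refine tendsto_nhds_unique a1 (a2.congr fun n => ?_)
    exact ((u n).inner_left x y).symm
  · rw [tendsto_iff_norm_sub_tendsto_zero] at hS ⊢
    exact hS

noncomputable instance : CStarAlgebra (Adjointable A E E) where

end Adjointable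

end Modules

/-! ### The Hilbert module of a positive definite kernel -/

section Kernel

open MulOpposite UniformSpace SemiHilbertModule

section Finsupp

variable {X A : Type*} [CStarAlgebra A]

/-- `⟨∑ x·a, ∑ y·b⟩ = ∑ a* k(x, y) b`. -/
noncomputable def kInner (k : X → X → A) (f g : X →₀ A) : A :=
  f.sum fun x a => g.sum fun y b => star a * k x y * b

theorem kInner_add (k : X → X → A) (f g h : X →₀ A) :
    kInner k f (g + h) = kInner k f g + kInner k f h := by
  classical
  rw [kInner, kInner, kInner, ← Finsupp.sum_add]
  refine Finsupp.sum_congr fun x _ => ?_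
  exact Finsupp.sum_add_index' (by simp) (by simp [mul_add])

theorem kInner_smul (k : X → X → A) (c : ℂ) (f g : X →₀ A) :
    kInner k f (c • g) = c • kInner k f g := by
  rw [kInner, kInner, Finsupp.smul_sum]
  refine Finsupp.sum_congr fun x _ => ?_
  rw [Finsupp.smul_sum]
  refine (Finsupp.sum_smul_index' (by simp)).trans ?_
  simp

theorem kInner_op_smul (k : X → X → A) (a : A) (f g : X →₀ A) :
    kInner k f (op a • g) = kInner k f g * a := by
  rw [kInner, kInner, Finsupp.sum_mul]
  refine Finsupp.sum_congr fun x _ => ?_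
  rw [Finsupp.sum_mul]
  refine (Finsupp.sum_smul_index' (by simp)).trans ?_
  simp [mul_assoc]

theorem star_kInner {k : X → X → A} (hk : ∀ x y, star (k x y) = k y x) (f g : X →₀ A) :
    star (kInner k f g) = kInner k g f := by
  simp only [kInner, Finsupp.sum]
  rw [star_sum, Finset.sum_comm]
  simp only [star_sum, star_mul, star_star, hk, mul_assoc]
  try rw [Finset.sum_comm]

variable {M : Type*} [AddCommGroup M] [Module ℂ M] [Module Aᵐᵒᵖ M] [SMulCommClass ℂ Aᵐᵒᵖ M]
  [IsScalarTower ℂ Aᵐᵒᵖ M]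

/-- The right `A`-linear map extending a map on generators. -/
noncomputable def fLift (φ : X → M) : (X →₀ A) →ₗ[ℂ] M where
  toFun f := f.sum fun x a => op a • φ x
  map_add' f g := by
    classical
    exact Finsupp.sum_add_index' (by simp) (by simp [add_smul])
  map_smul' c f := by
    rw [RingHom.id_apply, Finsupp.smul_sum]
    refine (Finsupp.sum_smul_index' (by simp)).trans ?_
    simp

theorem fLift_single (φ : X → M) (x : X) : fLift φ (Finsupp.single x (1 : A)) = φ x := by
  change Finsupp.sum (Finsupp.single x (1 : A)) (fun x a => op a • φ x) = _
  rw [Finsupp.sum_single_index] <;> simp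

theorem fLift_op_smul (φ : X → M) (a : A) (f : X →₀ A) :
    fLift φ (op a • f) = op a • fLift φ f := by
  change (op a • f).sum (fun x a => op a • φ x) = op a • f.sum (fun x a => op a • φ x)
  rw [Finsupp.smul_sum]
  refine (Finsupp.sum_smul_index' (by simp)).trans ?_
  simp [mul_smul]

end Finsupp

/-- A positive definite `A`-valued kernel on the set `X`. -/
structure PDKernel (X A : Type*) [CStarAlgebra A] where
  k : X → X → A
  star_k (x y : X) : star (k x y) = k y x
  pos (s : Finset X) (c : X → A) : IsPos (∑ x ∈ s, ∑ y ∈ s, star (c x) * k x y * c y)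

/-- Formal finite combinations `∑ x·a` (`x ∈ X`, `a ∈ A`), to be equipped with the semi-inner
product `⟨x·a, y·b⟩ = a* k(x, y) b`. -/
def KernelModule {X A : Type*} [CStarAlgebra A] (_ : PDKernel X A) := X →₀ A

namespace KernelModule

variable {X Y A : Type*} [CStarAlgebra A] {K : PDKernel X A} {L : PDKernel Y A}

noncomputable instance : AddCommGroup (KernelModule K) := inferInstanceAs (AddCommGroup (X →₀ A))
noncomputable instance : Module ℂ (KernelModule K) := inferInstanceAs (Module ℂ (X →₀ A))
noncomputable instance : Module Aᵐᵒᵖ (KernelModule K) := inferInstanceAs (Module Aᵐᵒᵖ (X →₀ A))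
instance : SMulCommClass ℂ Aᵐᵒᵖ (KernelModule K) :=
  inferInstanceAs (SMulCommClass ℂ Aᵐᵒᵖ (X →₀ A))
instance : IsScalarTower ℂ Aᵐᵒᵖ (KernelModule K) :=
  inferInstanceAs (IsScalarTower ℂ Aᵐᵒᵖ (X →₀ A))

/-- The generator given by `x`. -/
noncomputable def of (K : PDKernel X A) (x : X) : KernelModule K := Finsupp.single x (1 : A)

theorem op_smul_of (a : A) (x : X) : op a • of K x = (Finsupp.single x a : X →₀ A) := by
  change op a • (Finsupp.single x (1 : A)) = _
  rw [Finsupp.smul_single, op_smul_eq_mul, one_mul]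

@[elab_as_elim]
theorem ind {P : KernelModule K → Prop} (f : KernelModule K) (h0 : P 0)
    (hadd : ∀ f g, P f → P g → P (f + g)) (hof : ∀ (a : A) x, P (op a • of K x)) : P f := by
  refine Finsupp.induction_linear (motive := P) f h0 hadd fun x a => ?_
  rw [← op_smul_of (K := K)]
  exact hof a x

noncomputable instance : SemiHilbertModule A (KernelModule K) where
  inner f g := kInner K.k f g
  ip_add_right := kInner_add K.k
  ip_smul_right := kInner_smul K.k
  ip_op_smul_right := kInner_op_smul K.k
  star_ip := star_kInner K.star_k
  ip_self_pos f := K.pos _ _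

theorem inner_of_of (x y : X) : inner A (of K x) (of K y) = K.k x y := by
  change kInner K.k (Finsupp.single x (1 : A)) (Finsupp.single y (1 : A)) = _
  rw [kInner, Finsupp.sum_single_index, Finsupp.sum_single_index] <;> simp

noncomputable instance : Norm (KernelModule K) := toNorm A (KernelModule K)
noncomputable instance : SeminormedAddCommGroup (KernelModule K) :=
  .ofCore (core A (KernelModule K))
noncomputable instance : NormedSpace ℂ (KernelModule K) where
  norm_smul_le c x := ((core A (KernelModule K)).norm_smul c x).le
instance : InnerNorm A (KernelModule K) where
  norm_sq x := by
    change (√‖inner A x x‖) ^ 2 = _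
    exact Real.sq_sqrt (norm_nonneg _)
instance : UniformContinuousConstSMul Aᵐᵒᵖ (KernelModule K) := uniformContinuousConstSMul A _

/-- The right `A`-linear map extending a map on generators. -/
noncomputable def lift (φ : X → KernelModule L) : KernelModule K →ₗ[ℂ] KernelModule L :=
  fLift φ

theorem lift_of (φ : X → KernelModule L) (x : X) : lift (K := K) φ (of K x) = φ x :=
  fLift_single φ x

theorem lift_op_smul (φ : X → KernelModule L) (a : A) (f : KernelModule K) :
    lift φ (op a • f) = op a • lift φ f :=
  fLift_op_smul φ a f

/-- Formal adjointness can be tested on generators. -/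
theorem lift_adjoint {φ : X → KernelModule L} {ψ : Y → KernelModule K}
    (h : ∀ x y, inner A (φ x) (of L y) = inner A (of K x) (ψ y)) (f : KernelModule K)
    (g : KernelModule L) : inner A (lift φ f) g = inner A f (lift ψ g) := by
  refine ind f ?_ ?_ fun a x => ?_
  · rw [map_zero, ip_zero_left, ip_zero_left]
  · intro f₁ f₂ h₁ h₂
    rw [map_add, ip_add_left, ip_add_left, h₁, h₂]
  rw [lift_op_smul, lift_of, ip_op_smul_left, ip_op_smul_left]
  congr 1
  refine ind g ?_ ?_ fun b y => ?_
  · rw [map_zero, ip_zero_right, ip_zero_right]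
  · intro g₁ g₂ h₁ h₂
    rw [map_add, ip_add_right, ip_add_right, h₁, h₂]
  rw [lift_op_smul, lift_of, ip_op_smul_right, ip_op_smul_right, h]

/-- The Hilbert module of the kernel `K`. -/
abbrev Hilb (K : PDKernel X A) := Completion (KernelModule K)

/-- The vector of the Hilbert module given by a generator. -/
noncomputable def vec (K : PDKernel X A) (x : X) : Hilb K := ((of K x : KernelModule K) : Hilb K)

theorem inner_vec (x y : X) : inner A (vec K x) (vec K y) = K.k x y :=
  (completion_inner_coe (of K x) (of K y)).trans (inner_of_of x y)

/-- The adjointable operator given by two formally adjoint bounded maps on generators. -/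
noncomputable def mkAdjointable (φ : X → KernelModule L) (ψ : Y → KernelModule K)
    (h : ∀ x y, inner A (φ x) (of L y) = inner A (of K x) (ψ y)) (C : ℝ)
    (hφ : ∀ f : KernelModule K, ‖lift φ f‖ ≤ C * ‖f‖)
    (hψ : ∀ g : KernelModule L, ‖lift ψ g‖ ≤ C * ‖g‖) : Adjointable A (Hilb K) (Hilb L) where
  toCLM := ((lift φ).mkContinuous C hφ).completion
  adjCLM := ((lift ψ).mkContinuous C hψ).completion
  inner_left x y := by
    refine Completion.induction_on₂ x y (isClosed_eq ?_ ?_) fun f g => ?_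
    · exact completion_continuous_ip' ((ContinuousLinearMap.continuous _).comp continuous_fst)
        continuous_snd
    · exact completion_continuous_ip' continuous_fst
        ((ContinuousLinearMap.continuous _).comp continuous_snd)
    · rw [ContinuousLinearMap.completion_apply_coe, ContinuousLinearMap.completion_apply_coe,
        completion_inner_coe, completion_inner_coe]
      exact lift_adjoint h f g

theorem mkAdjointable_vec (φ : X → KernelModule L) (ψ : Y → KernelModule K)
    (h : ∀ x y, inner A (φ x) (of L y) = inner A (of K x) (ψ y)) (C : ℝ)
    (hφ : ∀ f : KernelModule K, ‖lift φ f‖ ≤ C * ‖f‖)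
    (hψ : ∀ g : KernelModule L, ‖lift ψ g‖ ≤ C * ‖g‖) (x : X) :
    (mkAdjointable φ ψ h C hφ hψ).toCLM (vec K x) = ((φ x : KernelModule L) : Hilb L) := by
  refine (ContinuousLinearMap.completion_apply_coe _ _).trans ?_
  exact congrArg _ (lift_of φ x)

/-- A vector of the Hilbert module is determined by its inner products with the generators. -/
theorem eq_of_inner_vec {v w : Hilb K} (h : ∀ y, inner A v (vec K y) = inner A w (vec K y)) :
    v = w := by
  refine Adjointable.eq_of_inner (A := A) fun z => ?_
  refine Completion.induction_on z (isClosed_eq ?_ ?_) fun f => ?_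
  · exact completion_continuous_ip' continuous_id continuous_const
  · exact completion_continuous_ip' continuous_id continuous_const
  refine ind f ?_ ?_ fun a x => ?_
  · rw [Completion.coe_zero, ip_zero_left, ip_zero_left]
  · intro f₁ f₂ h₁ h₂
    rw [Completion.coe_add, ip_add_left, ip_add_left, h₁, h₂]
  · rw [Completion.coe_smul, ip_op_smul_left, ip_op_smul_left, ← star_ip v, ← star_ip w]
    exact congrArg _ (congrArg _ (h x))

end KernelModule

namespace KernelModule

variable {X Y A : Type*} [CStarAlgebra A] {K : PDKernel X A} {L : PDKernel Y A}

/-- A map on generators is bounded by `C` if `C²⟨x, y⟩ - ⟨φ x, φ y⟩` is the inner product of another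
map on generators. -/
theorem norm_lift_le (φ ψ : X → KernelModule L) (C : ℝ) (hC : 0 ≤ C)
    (h : ∀ x y, inner A (φ x) (φ y) + inner A (ψ x) (ψ y) =
      ((C ^ 2 : ℝ) : ℂ) • inner A (of K x) (of K y))
    (f : KernelModule K) : ‖lift φ f‖ ≤ C * ‖f‖ := by
  have key : ∀ f g : KernelModule K, inner A (lift φ f) (lift φ g) + inner A (lift ψ f) (lift ψ g) =
      ((C ^ 2 : ℝ) : ℂ) • inner A f g := by
    intro f g
    refine ind f ?_ ?_ fun a x => ?_
    · simp only [map_zero, ip_zero_left, smul_zero, add_zero]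
    · intro f₁ f₂ h₁ h₂
      simp only [map_add, ip_add_left, smul_add, ← h₁, ← h₂]
      abel
    refine ind g ?_ ?_ fun b y => ?_
    · simp only [map_zero, ip_zero_right, smul_zero, add_zero]
    · intro g₁ g₂ h₁ h₂
      simp only [map_add, ip_add_right, smul_add, ← h₁, ← h₂]
      abel
    simp only [lift_op_smul, lift_of, ip_op_smul_right, ip_op_smul_left]
    rw [← add_mul, ← mul_add, h, mul_smul_comm, smul_mul_assoc]
  have h1 : ‖inner A (lift φ f) (lift φ f)‖ ≤ ‖((C ^ 2 : ℝ) : ℂ) • inner A f f‖ := by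
    refine (ip_self_pos _).norm_le ?_
    rw [← key, add_sub_cancel_left]
    exact ip_self_pos _
  refine (pow_le_pow_iff_left₀ (norm_nonneg _) (by positivity) two_ne_zero).mp ?_
  rw [InnerNorm.norm_sq (A := A), mul_pow, InnerNorm.norm_sq (A := A) f]
  rw [norm_smul, Complex.norm_real, Real.norm_of_nonneg (by positivity)] at h1
  exact h1

/-- The inner product of the image of a generator under an operator given by a map on generators. -/
theorem inner_mkAdjointable (φ : X → KernelModule L) (ψ : Y → KernelModule K)
    (h : ∀ x y, inner A (φ x) (of L y) = inner A (of K x) (ψ y)) (C : ℝ)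
    (hφ : ∀ f : KernelModule K, ‖lift φ f‖ ≤ C * ‖f‖)
    (hψ : ∀ g : KernelModule L, ‖lift ψ g‖ ≤ C * ‖g‖) (x : X) (y : Y) :
    inner A ((mkAdjointable φ ψ h C hφ hψ).toCLM (vec K x)) (vec L y) =
      inner A (φ x) (of L y) := by
  rw [mkAdjointable_vec]
  exact completion_inner_coe _ _

theorem mkAdjointable_coe (φ : X → KernelModule L) (ψ : Y → KernelModule K)
    (h : ∀ x y, inner A (φ x) (of L y) = inner A (of K x) (ψ y)) (C : ℝ)
    (hφ : ∀ f : KernelModule K, ‖lift φ f‖ ≤ C * ‖f‖)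
    (hψ : ∀ g : KernelModule L, ‖lift ψ g‖ ≤ C * ‖g‖) (f : KernelModule K) :
    (mkAdjointable φ ψ h C hφ hψ).toCLM (f : Hilb K) = ((lift φ f : KernelModule L) : Hilb L) :=
  ContinuousLinearMap.completion_apply_coe _ _

end KernelModule

open KernelModule in
theorem Adjointable.ext_vec {X A F : Type*} [CStarAlgebra A] {K : PDKernel X A}
    [NormedAddCommGroup F] [NormedSpace ℂ F] [Module Aᵐᵒᵖ F] [HilbertModule A F]
    {S T : Adjointable A (Hilb K) F}
    (h : ∀ x, S.toCLM (vec K x) = T.toCLM (vec K x)) : S = T := by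
  have lin : ∀ (R : Adjointable A (Hilb K) F) (a : A) v,
      R.toCLM (op a • v) = op a • R.toCLM v := fun R a v => by
    refine Adjointable.eq_of_inner (A := A) fun z => ?_
    rw [R.inner_right, ip_op_smul_right, ip_op_smul_right, R.inner_right]
  ext v
  refine Completion.induction_on v (isClosed_eq S.toCLM.continuous T.toCLM.continuous) fun f => ?_
  refine ind f ?_ ?_ fun a x => ?_
  · rw [Completion.coe_zero, map_zero, map_zero]
  · intro f₁ f₂ h₁ h₂
    rw [Completion.coe_add, map_add, map_add, h₁, h₂]
  · rw [Completion.coe_smul, lin, lin]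
    exact congrArg _ (h x)

end Kernel

/-! ### Conditional expectations -/

section CondExp

/-- A conditional expectation of `A` onto the subalgebra `D`: a positive `D`-bimodule projection. -/
structure ConditionalExpectation {A : Type*} [Ring A] [StarRing A] [Algebra ℂ A] [StarModule ℂ A]
    (D : StarSubalgebra ℂ A) where
  toLinearMap : A →ₗ[ℂ] D
  map_coe (d : D) : toLinearMap (d : A) = d
  map_mul_mul (d d' : D) (x : A) : toLinearMap (d * x * d') = d * toLinearMap x * d'
  map_pos (x : A) : IsPos (toLinearMap (star x * x))

namespace ConditionalExpectation

variable {A : Type*} [Ring A] [StarRing A] [Algebra ℂ A] [StarModule ℂ A] {D : StarSubalgebra ℂ A}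

instance : CoeFun (ConditionalExpectation D) (fun _ => A → D) := ⟨fun E => E.toLinearMap⟩

/-- The GNS representation of `E` (left multiplication on the completion of `A` for the `D`-valued
inner product `⟨x, y⟩ = E(x* y)`) is faithful. -/
def GNSFaithful (E : ConditionalExpectation D) : Prop :=
  ∀ x : A, (∀ y : A, E (star (x * y) * (x * y)) = 0) → x = 0

variable (E : ConditionalExpectation D)

theorem map_mul_left (d : D) (x : A) : E (d * x) = d * E x := by
  simpa using E.map_mul_mul d 1 x

theorem map_mul_right (d : D) (x : A) : E (x * d) = E x * d := by
  simpa using E.map_mul_mul 1 d x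

theorem star_map_star_mul (x y : A) : star (E (star x * y)) = E (star y * x) := by
  have sa : ∀ z : A, star (E (star z * z)) = E (star z * z) := fun z => by
    obtain ⟨b, hb⟩ := E.map_pos z
    rw [hb, star_mul, star_star]
  have h1 := sa (x + y)
  have h2 := sa (x + Complex.I • y)
  have hx := sa x
  have hy := sa y
  have e1 : star (x + y) * (x + y) = star x * x + star y * y + (star x * y + star y * x) := by
    rw [star_add]; noncomm_ring
  have e2 : star (x + Complex.I • y) * (x + Complex.I • y) =
      star x * x + star y * y + Complex.I • (star x * y - star y * x) := by
    rw [star_add, star_smul, RCLike.star_def, Complex.conj_I]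
    simp only [add_mul, mul_add, smul_mul_assoc, mul_smul_comm]
    match_scalars <;> simp
  rw [e1] at h1
  rw [e2] at h2
  simp only [map_add, map_smul, map_sub, star_add, star_smul, star_sub, hx, hy] at h1 h2
  rw [add_right_inj] at h1 h2
  rw [RCLike.star_def, Complex.conj_I, neg_smul, ← smul_neg] at h2
  have h3 := smul_right_injective D Complex.I_ne_zero h2
  have h4 : (2 : ℂ) • star (E (star x * y)) = (2 : ℂ) • E (star y * x) := by
    have : (2 : ℂ) • star (E (star x * y)) =
      (star (E (star x * y)) + star (E (star y * x))) -
        -(star (E (star x * y)) - star (E (star y * x))) := by module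
    rw [this, h1, h3]
    module
  exact smul_right_injective D (two_ne_zero (α := ℂ)) h4

theorem star_map (x : A) : star (E x) = E (star x) := by
  have := E.star_map_star_mul 1 x
  simpa using this

end ConditionalExpectation

end CondExp

/-! ### Graphs of C*-algebras -/

/-- Paths `(e₁, …, eₙ)`, `n ≥ 0`, built by adding edges on the left. -/
inductive EdgePath {V : Type u₁} [Quiver.{u₂} V] : V → V → Type (max u₁ u₂)
  | nil (p : V) : EdgePath p p
  | cons {q r p : V} (e : q ⟶ r) (w : EdgePath r p) : EdgePath q p

/-- The number of edges of a path. -/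
def EdgePath.length {V : Type u₁} [Quiver.{u₂} V] : ∀ {q p : V}, EdgePath q p → ℕ
  | _, _, .nil _ => 0
  | _, _, .cons _ w => w.length + 1

/-- The edge `f` is the inverse of the edge `e`. -/
def IsBack {V : Type u₁} [Quiver.{u₂} V] [Quiver.HasReverse V] {q r r' : V} (e : q ⟶ r)
    (f : r ⟶ r') : Prop :=
  (⟨r', f⟩ : Σ x, r ⟶ x) = ⟨q, Quiver.reverse e⟩

/-- A graph of C*-algebras over a connected graph with vertex set `V`; the edges from `p` to `q` are
the arrows `p ⟶ q` and `reverse` is the inversion `e ↦ ē`. The equality `B_ē = B_e` is given by the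
isomorphism `flip e` of `B_e` with `B_ē`, with `flip ē ∘ flip e = id`. -/
structure GraphOfCStarAlgebras (V : Type u₁) [Quiver.{u₂} V] [Quiver.HasInvolutiveReverse V] where
  reverse_ne {p : V} (e : p ⟶ p) : Quiver.reverse e ≠ e
  connected (p q : V) : Nonempty (EdgePath p q)
  A : V → Type u₃
  [cstarA : ∀ p, CStarAlgebra (A p)]
  B : ∀ {p q : V}, (p ⟶ q) → Type u₄
  [cstarB : ∀ {p q : V} (e : p ⟶ q), CStarAlgebra (B e)]
  flip : ∀ {p q : V} (e : p ⟶ q), B e ≃⋆ₐ[ℂ] B (Quiver.reverse e)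
  flip_flip {p q : V} (e : p ⟶ q) (b : B e) : HEq (flip (Quiver.reverse e) (flip e b)) b
  s : ∀ {p q : V} (e : p ⟶ q), B e →⋆ₐ[ℂ] A p
  s_injective {p q : V} (e : p ⟶ q) : Function.Injective (s e)

attribute [instance] GraphOfCStarAlgebras.cstarA GraphOfCStarAlgebras.cstarB

namespace GraphOfCStarAlgebras

variable {V : Type u₁} [Quiver.{u₂} V] [Quiver.HasInvolutiveReverse V]
  (G : GraphOfCStarAlgebras.{u₁, u₂, u₃, u₄} V)

/-- `r_e = s_ē : B_e → A_{r(e)}`. -/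
noncomputable def r {p q : V} (e : p ⟶ q) : G.B e →⋆ₐ[ℂ] G.A q :=
  (G.s (Quiver.reverse e)).comp (G.flip e : G.B e →⋆ₐ[ℂ] G.B (Quiver.reverse e))

theorem r_apply {p q : V} (e : p ⟶ q) (b : G.B e) :
    G.r e b = G.s (Quiver.reverse e) (G.flip e b) := rfl

theorem r_reverse {p q : V} (e : p ⟶ q) (b : G.B e) :
    G.r (Quiver.reverse e) (G.flip e b) = G.s e b := by
  have key : ∀ (e' : p ⟶ q) (_ : e' = e) (b' : G.B e'), HEq b' b → G.s e' b' = G.s e b := by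
    rintro e' rfl b' hb
    rw [eq_of_heq hb]
  exact key _ (Quiver.reverse_reverse e) _ (G.flip_flip e b)

/-- A family of conditional expectations `E_e^s : A_{s(e)} → B_e^s = s_e(B_e)`. -/
structure Expectations where
  E : ∀ {p q : V} (e : p ⟶ q), ConditionalExpectation (G.s e).range

/-- The letters `(a₀, …, aₙ)` of a word along the path `(e₁, …, eₙ)` from `q` to `p`: `a₀ ∈ A_q` and
`aᵢ ∈ A_{r(eᵢ)}`. -/
inductive Tuple : ∀ {q p : V}, EdgePath q p → Type (max u₁ u₂ u₃)
  | base {p : V} (a : G.A p) : Tuple (.nil p)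
  | cons {q r p : V} {e : q ⟶ r} {w : EdgePath r p} (a : G.A q) (t : Tuple w) : Tuple (.cons e w)

variable {G}

/-- Left multiplication of the first letter. -/
def lmul : ∀ {q p : V} {w : EdgePath q p}, G.A q → G.Tuple w → G.Tuple w
  | _, _, _, a, .base b => .base (a * b)
  | _, _, _, a, .cons b t => .cons (a * b) t

/-- The tuple with all letters zero. -/
def zeroTuple : ∀ {q p : V} (w : EdgePath q p), G.Tuple w
  | _, _, .nil _ => .base 0
  | _, _, .cons _ w => .cons 0 (zeroTuple w)

theorem one_lmul : ∀ {q p : V} {w : EdgePath q p} (t : G.Tuple w), lmul (1 : G.A q) t = t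
  | _, _, _, .base b => by rw [lmul, one_mul]
  | _, _, _, .cons b t => by rw [lmul, one_mul]

theorem mul_lmul : ∀ {q p : V} {w : EdgePath q p} (a b : G.A q) (t : G.Tuple w),
    lmul (a * b) t = lmul a (lmul b t)
  | _, _, _, a, b, .base c => by rw [lmul, lmul, lmul, mul_assoc]
  | _, _, _, a, b, .cons c t => by rw [lmul, lmul, lmul, mul_assoc]

namespace Expectations

variable (E : G.Expectations)

/-- `s_e⁻¹ ∘ E_e^s`. -/
noncomputable def eps {p q : V} (e : p ⟶ q) : G.A p →ₗ[ℂ] G.B e where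
  toFun x := (StarAlgEquiv.ofInjective (G.s e) (G.s_injective e)).symm (E.E e x)
  map_add' x y := by rw [map_add, map_add]
  map_smul' c x := by rw [map_smul, map_smul]; rfl

theorem s_eps {p q : V} (e : p ⟶ q) (x : G.A p) : G.s e (E.eps e x) = (E.E e x : G.A p) := by
  have h := (StarAlgEquiv.ofInjective (G.s e) (G.s_injective e)).apply_symm_apply (E.E e x)
  exact congrArg Subtype.val h

theorem eps_s {p q : V} (e : p ⟶ q) (b : G.B e) : E.eps e (G.s e b) = b := by
  apply G.s_injective e
  rw [s_eps]
  exact congrArg Subtype.val ((E.E e).map_coe ⟨G.s e b, b, rfl⟩)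

theorem eps_s_mul {p q : V} (e : p ⟶ q) (b : G.B e) (x : G.A p) :
    E.eps e (G.s e b * x) = b * E.eps e x := by
  apply G.s_injective e
  rw [map_mul (G.s e), s_eps, s_eps]
  exact congrArg Subtype.val ((E.E e).map_mul_left ⟨G.s e b, b, rfl⟩ x)

theorem eps_mul_s {p q : V} (e : p ⟶ q) (b : G.B e) (x : G.A p) :
    E.eps e (x * G.s e b) = E.eps e x * b := by
  apply G.s_injective e
  rw [map_mul (G.s e), s_eps, s_eps]
  exact congrArg Subtype.val ((E.E e).map_mul_right ⟨G.s e b, b, rfl⟩ x)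

theorem star_eps {p q : V} (e : p ⟶ q) (x : G.A p) : star (E.eps e x) = E.eps e (star x) := by
  apply G.s_injective e
  rw [map_star, s_eps, s_eps, ← (E.E e).star_map]
  rfl

theorem eps_pos {p q : V} (e : p ⟶ q) (x : G.A p) : IsPos (E.eps e (star x * x)) := by
  obtain ⟨⟨_, b, rfl⟩, hb⟩ := (E.E e).map_pos x
  refine ⟨b, ?_⟩
  apply G.s_injective e
  rw [s_eps, hb, map_mul, map_star]
  rfl

/-- `r_e ∘ s_e⁻¹ ∘ E_e^s : A_{s(e)} → A_{r(e)}`. -/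
noncomputable def phi {p q : V} (e : p ⟶ q) : G.A p →ₗ[ℂ] G.A q where
  toFun x := G.r e (E.eps e x)
  map_add' x y := by rw [map_add, map_add]
  map_smul' c x := by rw [map_smul, map_smul]; rfl

theorem phi_apply {p q : V} (e : p ⟶ q) (x : G.A p) : E.phi e x = G.r e (E.eps e x) := rfl

theorem star_phi {p q : V} (e : p ⟶ q) (x : G.A p) : star (E.phi e x) = E.phi e (star x) := by
  rw [phi_apply, phi_apply, ← map_star, star_eps]

/-- `phi` is completely positive. -/
theorem phi_factor {p q : V} (e : p ⟶ q) {ι : Type*} [Fintype ι] (c : ι → G.A p) :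
    ∃ k : ι → ι → G.A q, ∀ i j, E.phi e (star (c i) * c j) = ∑ l, star (k l i) * k l j := by
  classical
  obtain ⟨k, hk⟩ := exists_factor (fun i j => E.eps e (star (c i) * c j))
    (fun i j => by rw [star_eps, star_mul, star_star]) (fun b => by
      have := E.eps_pos e (∑ i, c i * G.s e (b i))
      convert this using 1
      rw [star_sum, Finset.sum_mul_sum, map_sum]
      refine Finset.sum_congr rfl fun i _ => ?_
      rw [map_sum]
      refine Finset.sum_congr rfl fun j _ => ?_
      rw [star_mul, ← map_star, ← mul_assoc, eps_mul_s, mul_assoc (G.s e _), eps_s_mul])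
  refine ⟨fun l i => G.r e (k l i), fun i j => ?_⟩
  rw [phi_apply, hk, map_sum]
  simp only [map_mul, map_star]

/-! #### Reduced words -/

/-- The first letter of a word following the edge `e` satisfies the condition of reduced words:
if the first edge is `f = ē`, the first letter `a` has `E_f^s(a) = 0`. -/
def StartReduced {q₀ q : V} (e : q₀ ⟶ q) : ∀ {p : V} {w : EdgePath q p}, G.Tuple w → Prop
  | _, _, .base _ => True
  | _, _, .cons (e := f) a _ => IsBack e f → E.E f a = 0

/-- The word `a₀ e₁ a₁ ⋯ eₙ aₙ` is reduced: `E_{e_{i+1}}^s(aᵢ) = 0` for all `1 ≤ i ≤ n - 1` with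
`e_{i+1} = ēᵢ`. -/
def Reduced : ∀ {q p : V} {w : EdgePath q p}, G.Tuple w → Prop
  | _, _, _, .base _ => True
  | _, _, _, .cons (e := e) _ t => E.StartReduced e t ∧ Reduced t

theorem reduced_lmul : ∀ {q p : V} {w : EdgePath q p} (a : G.A q) (t : G.Tuple w),
    E.Reduced t → E.Reduced (lmul a t)
  | _, _, _, _, .base _, h => h
  | _, _, _, _, .cons _ _, h => h

/-- Reduced words from `q` to `p`. They index the elementary tensors
`â₀ ⊗ ⋯ ⊗ âₙ₋₁ ⊗ aₙ` of the path Hilbert modules. -/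
structure RWord (q p : V) where
  path : EdgePath q p
  tuple : G.Tuple path
  reduced : E.Reduced tuple

/-- The form `(x; a, b) ↦ xₙ`, where `x₀ = a₀* x b₀` and `xₖ = aₖ* r_e(s_e⁻¹(E_e^s(xₖ₋₁))) bₖ` for
`e = eₖ`. For `x = 1` it is the inner product of elementary tensors in the interior tensor product
`K₀ ⊗ ⋯ ⊗ Kₙ`. -/
noncomputable def form : ∀ {q p : V} {w : EdgePath q p}, G.A q → G.Tuple w → G.Tuple w → G.A p
  | _, _, _, x, .base a, .base b => star a * x * b
  | _, _, _, x, .cons (e := e) a t, .cons b t' => form (E.phi e (star a * x * b)) t t'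

theorem form_add : ∀ {q p : V} {w : EdgePath q p} (x y : G.A q) (t t' : G.Tuple w),
    E.form (x + y) t t' = E.form x t t' + E.form y t t'
  | _, _, _, x, y, .base a, .base b => by
    simp only [form]
    rw [mul_add, add_mul]
  | _, _, _, x, y, .cons a t, .cons b t' => by
    rw [form, form, form, mul_add, add_mul, map_add, form_add]

theorem form_smul : ∀ {q p : V} {w : EdgePath q p} (c : ℂ) (x : G.A q) (t t' : G.Tuple w),
    E.form (c • x) t t' = c • E.form x t t'
  | _, _, _, c, x, .base a, .base b => by
    simp only [form]
    rw [mul_smul_comm, smul_mul_assoc]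
  | _, _, _, c, x, .cons a t, .cons b t' => by
    rw [form, form, mul_smul_comm, smul_mul_assoc, map_smul, form_smul]

/-- `form` as a linear map. -/
noncomputable def formₗ {q p : V} {w : EdgePath q p} (t t' : G.Tuple w) : G.A q →ₗ[ℂ] G.A p where
  toFun x := E.form x t t'
  map_add' x y := E.form_add x y t t'
  map_smul' c x := E.form_smul c x t t'

theorem form_zero {q p : V} {w : EdgePath q p} (t t' : G.Tuple w) : E.form 0 t t' = 0 :=
  map_zero (E.formₗ t t')

theorem form_sum {q p : V} {w : EdgePath q p} {ι : Type*} (s : Finset ι) (x : ι → G.A q)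
    (t t' : G.Tuple w) : E.form (∑ i ∈ s, x i) t t' = ∑ i ∈ s, E.form (x i) t t' :=
  map_sum (E.formₗ t t') x s

theorem star_form : ∀ {q p : V} {w : EdgePath q p} (x : G.A q) (t t' : G.Tuple w),
    star (E.form x t t') = E.form (star x) t' t
  | _, _, _, x, .base a, .base b => by
    simp only [form]
    rw [star_mul, star_mul, star_star, mul_assoc]
  | _, _, _, x, .cons a t, .cons b t' => by
    rw [form, form, star_form, star_phi, star_mul, star_mul, star_star, mul_assoc]

theorem form_lmul_left : ∀ {q p : V} {w : EdgePath q p} (x a : G.A q) (t t' : G.Tuple w),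
    E.form x (lmul a t) t' = E.form (star a * x) t t'
  | _, _, _, x, a, .base b, .base c => by
    simp only [form, lmul]
    simp only [star_mul, mul_assoc]
  | _, _, _, x, a, .cons b t, .cons c t' => by
    rw [lmul, form, form]
    simp only [star_mul, mul_assoc]

theorem form_lmul_right : ∀ {q p : V} {w : EdgePath q p} (x a : G.A q) (t t' : G.Tuple w),
    E.form x t (lmul a t') = E.form (x * a) t t'
  | _, _, _, x, a, .base b, .base c => by
    simp only [form, lmul]
    simp only [mul_assoc]
  | _, _, _, x, a, .cons b t, .cons c t' => by
    rw [lmul, form, form]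
    simp only [mul_assoc]

/-- The first letter. -/
def head : ∀ {q p : V} {w : EdgePath q p}, G.Tuple w → G.A q
  | _, _, _, .base a => a
  | _, _, _, .cons a _ => a

/-- All letters but the first. -/
def tail : ∀ {q r p : V} {e : q ⟶ r} {w : EdgePath r p}, G.Tuple (.cons e w) → G.Tuple w
  | _, _, _, _, _, .cons _ t => t

theorem form_nil : ∀ {p : V} (x : G.A p) (t t' : G.Tuple (.nil p)),
    E.form x t t' = star (head t) * x * head t'
  | _, _, .base _, .base _ => rfl

theorem form_cons : ∀ {q r p : V} {e : q ⟶ r} {w : EdgePath r p} (x : G.A q)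
    (t t' : G.Tuple (.cons e w)),
    E.form x t t' = E.form (E.phi e (star (head t) * x * head t')) (tail t) (tail t')
  | _, _, _, _, _, _, .cons _ _, .cons _ _ => by rw [form]; rfl

theorem form_pos {q p : V} (w : EdgePath q p) {ι : Type*} [Fintype ι]
    (c : ι → G.A q) (t : ι → G.Tuple w) (d : ι → G.A p) :
    IsPos (∑ i, ∑ j, star (d i) * E.form (star (c i) * c j) (t i) (t j) * d j) := by
  induction w with
  | nil p =>
    refine ⟨∑ i, c i * head (t i) * d i, ?_⟩
    rw [star_sum, Finset.sum_mul_sum]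
    refine Finset.sum_congr rfl fun i _ => Finset.sum_congr rfl fun j _ => ?_
    rw [form_nil]
    simp only [star_mul, mul_assoc]
  | cons e w ih =>
    obtain ⟨k, hk⟩ := E.phi_factor e (fun i => c i * head (t i))
    have : ∑ i, ∑ j, star (d i) * E.form (star (c i) * c j) (t i) (t j) * d j =
        ∑ l, ∑ i, ∑ j, star (d i) * E.form (star (k l i) * k l j) (tail (t i)) (tail (t j)) *
          d j := by
      rw [Finset.sum_comm]
      rw [Finset.sum_comm]
      conv_rhs => rw [Finset.sum_comm]
      refine Finset.sum_congr rfl fun i _ => ?_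
      conv_rhs => rw [Finset.sum_comm]
      refine Finset.sum_congr rfl fun j _ => ?_
      have : E.form (star (c i) * c j) (t i) (t j) =
          E.form (E.phi e (star (c i * head (t i)) * (c j * head (t j)))) (tail (t i))
            (tail (t j)) := by
        rw [form_cons]
        simp only [star_mul, mul_assoc]
      rw [this, hk, form_sum, Finset.mul_sum, Finset.sum_mul]
    rw [this]
    exact IsPos.sum _ _ fun l _ => ih (k l) (fun i => tail (t i)) d

open Classical in
/-- The kernel on reduced words: the inner product of elementary tensors, with different paths
orthogonal. -/
noncomputable def kern {q p : V} (x y : E.RWord q p) : G.A p :=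
  if h : x.path = y.path then E.form 1 (h ▸ x.tuple) y.tuple else 0

theorem kern_mk {q p : V} {w : EdgePath q p} (t t' : G.Tuple w) (h : E.Reduced t)
    (h' : E.Reduced t') : E.kern ⟨w, t, h⟩ ⟨w, t', h'⟩ = E.form 1 t t' := by
  simp [kern]

theorem kern_ne {q p : V} {x y : E.RWord q p} (h : x.path ≠ y.path) : E.kern x y = 0 := by
  simp [kern, h]

theorem star_kern {q p : V} (x y : E.RWord q p) : star (E.kern x y) = E.kern y x := by
  obtain ⟨w, t, ht⟩ := x
  obtain ⟨w', t', ht'⟩ := y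
  by_cases h : w = w'
  · subst h
    rw [kern_mk, kern_mk, star_form, star_one]
  · rw [kern_ne _ h, kern_ne _ (Ne.symm h), star_zero]

theorem kern_pos {q p : V} (s : Finset (E.RWord q p)) (c : E.RWord q p → G.A p) :
    IsPos (∑ x ∈ s, ∑ y ∈ s, star (c x) * E.kern x y * c y) := by
  classical
  let cw : EdgePath q p → s → G.A q := fun w x => if x.1.path = w then 1 else 0
  let tw : ∀ w : EdgePath q p, s → G.Tuple w :=
    fun w x => if h : x.1.path = w then h ▸ x.1.tuple else zeroTuple w
  have key : ∀ x y : s, E.kern x.1 y.1 =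
      ∑ w ∈ s.image RWord.path, E.form (star (cw w x) * cw w y) (tw w x) (tw w y) := by
    rintro ⟨⟨w, t, ht⟩, hx⟩ ⟨⟨w', t', ht'⟩, hy⟩
    rw [Finset.sum_eq_single w]
    · by_cases h : w = w'
      · subst h
        simp [cw, tw, kern_mk]
      · rw [kern_ne _ h]
        simp [cw, Ne.symm h, form_zero]
    · intro v _ hv
      simp [cw, Ne.symm hv, form_zero]
    · intro h
      exact absurd (Finset.mem_image_of_mem _ hx) h
  have : ∑ x ∈ s, ∑ y ∈ s, star (c x) * E.kern x y * c y =
      ∑ w ∈ s.image RWord.path, ∑ x : s, ∑ y : s,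
        star (c x) * E.form (star (cw w x) * cw w y) (tw w x) (tw w y) * c y := by
    rw [← Finset.sum_coe_sort s]
    rw [Finset.sum_comm (s := s.image RWord.path)]
    refine Finset.sum_congr rfl fun x _ => ?_
    rw [← Finset.sum_coe_sort s, Finset.sum_comm (s := s.image RWord.path)]
    refine Finset.sum_congr rfl fun y _ => ?_
    rw [key, Finset.mul_sum, Finset.sum_mul]
  rw [this]
  exact IsPos.sum _ _ fun w _ => E.form_pos w (cw w) (tw w) fun x => c x.1

/-- The positive definite kernel on reduced words from `q` to `p`. -/
noncomputable def kernel (q p : V) : PDKernel (E.RWord q p) (G.A p) where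
  k := E.kern
  star_k := E.star_kern
  pos := E.kern_pos


/-! #### Creation and annihilation of an edge on the left -/

open Classical in
/-- Replace the first letter `a` by `a - E_f^s(a)` if the first edge is `f = ē`. -/
noncomputable def projTuple {q₀ q : V} (e : q₀ ⟶ q) : ∀ {p : V} {w : EdgePath q p},
    G.Tuple w → G.Tuple w
  | _, _, .base a => .base a
  | _, _, .cons (e := f) a t => .cons (if IsBack e f then a - (E.E f a : G.A q) else a) t

theorem startReduced_proj {q₀ q : V} (e : q₀ ⟶ q) : ∀ {p : V} {w : EdgePath q p}
    (t : G.Tuple w), E.StartReduced e (E.projTuple e t)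
  | _, _, .base _ => trivial
  | _, _, .cons a t => fun hb => by
    rw [if_pos hb, map_sub, (E.E _).map_coe, sub_self]

theorem reduced_proj {q₀ q : V} (e : q₀ ⟶ q) : ∀ {p : V} {w : EdgePath q p}
    (t : G.Tuple w), E.Reduced t → E.Reduced (E.projTuple e t)
  | _, _, .base _, h => h
  | _, _, .cons _ _, h => h

theorem eps_eq_zero {p q : V} {e : p ⟶ q} {a : G.A p} (h : E.E e a = 0) : E.eps e a = 0 := by
  apply G.s_injective e
  rw [s_eps, h, map_zero]
  rfl

theorem form_proj {q₀ q : V} (e : q₀ ⟶ q) (b : G.A q₀) : ∀ {p : V} {w : EdgePath q p}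
    (t t' : G.Tuple w), E.StartReduced e t' →
      E.form (E.phi e b) (E.projTuple e t) t' = E.form (E.phi e b) t t'
  | _, _, .base _, .base _, _ => rfl
  | _, _, .cons (e := f) a t, .cons a' t', h => by
    rw [projTuple]
    by_cases hb : IsBack e f
    · have h' := E.eps_eq_zero (h hb)
      rw [if_pos hb, form, form]
      congr 1
      obtain ⟨rfl, h2⟩ := Sigma.mk.inj hb
      obtain rfl := eq_of_heq h2
      rw [phi_apply E (Quiver.reverse e), phi_apply E (Quiver.reverse e)]
      congr 1
      have hz : ∀ γ, E.eps (Quiver.reverse e) (G.s (Quiver.reverse e) γ * a') = 0 := fun γ => by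
        rw [eps_s_mul, h', mul_zero]
      rw [← s_eps, star_sub, sub_mul, sub_mul, map_sub, phi_apply, r_apply, ← map_star, ← map_mul,
        hz, sub_zero]
    · rw [if_neg hb]

/-- Add the edge `e` on the left, with the first letter projected to the elements killed by the
conditional expectation when `e` meets its inverse. -/
noncomputable def create {q r p : V} (e : q ⟶ r) (x : E.RWord r p) : E.RWord q p where
  path := .cons e x.path
  tuple := .cons 1 (E.projTuple e x.tuple)
  reduced := ⟨E.startReduced_proj e x.tuple, E.reduced_proj e x.tuple x.reduced⟩

/-- Left multiplication of a reduced word by `a ∈ A_q`. -/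
def lmulW {q p : V} (a : G.A q) (x : E.RWord q p) : E.RWord q p where
  path := x.path
  tuple := lmul a x.tuple
  reduced := E.reduced_lmul a x.tuple x.reduced

theorem reduced_cons {q r p : V} {e : q ⟶ r} {w : EdgePath r p} {a : G.A q} {t : G.Tuple w}
    (h₁ : E.StartReduced e t) (h₂ : E.Reduced t) : E.Reduced (.cons (e := e) a t) := ⟨h₁, h₂⟩

theorem create_mk {q r p : V} (e : q ⟶ r) {w : EdgePath r p} (t : G.Tuple w) (h : E.Reduced t) :
    E.create e ⟨w, t, h⟩ = ⟨.cons e w, .cons 1 (E.projTuple e t),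
      E.reduced_cons (E.startReduced_proj e t) (E.reduced_proj e t h)⟩ := rfl

theorem lmulW_mk {q p : V} (a : G.A q) {w : EdgePath q p} (t : G.Tuple w) (h : E.Reduced t) :
    E.lmulW a ⟨w, t, h⟩ = ⟨w, lmul a t, E.reduced_lmul a t h⟩ := rfl

theorem cons_ne {q r r' p : V} {e : q ⟶ r} {f : q ⟶ r'} (w : EdgePath r p) (w' : EdgePath r' p)
    (h : (⟨r', f⟩ : Σ x, q ⟶ x) ≠ ⟨r, e⟩) : EdgePath.cons e w ≠ EdgePath.cons f w' := by
  intro h'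
  cases h'
  exact h rfl

open KernelModule

open Classical in
/-- `strip` on the level of tuples. -/
noncomputable def stripT {r : V} : ∀ {q p : V} (_ : q ⟶ r) {w : EdgePath q p} (t : G.Tuple w),
    E.Reduced t → KernelModule (E.kernel r p)
  | _, _, _, _, .base _, _ => 0
  | q, p, e, _, .cons (r := r') (e := f) (w := w) a t, h =>
    if hf : (⟨r', f⟩ : Σ x, q ⟶ x) = ⟨r, e⟩ then
      of (E.kernel r p) ((Sigma.mk.inj hf).1 ▸
        (⟨w, lmul (E.phi f a) t, E.reduced_lmul _ t h.2⟩ : E.RWord r' p))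
    else 0

/-- If the first edge is `e` and the first letter is `a`, remove both and multiply the remaining
word by `r_e(s_e⁻¹(E_e^s(a)))` on the left; all other words are sent to zero. -/
noncomputable def strip {q r p : V} (e : q ⟶ r) (x : E.RWord q p) :
    KernelModule (E.kernel r p) := E.stripT e x.tuple x.reduced

theorem strip_base {r p : V} (e : p ⟶ r) (a : G.A p) (h) :
    E.strip e (⟨.nil p, .base a, h⟩ : E.RWord p p) = 0 := rfl

theorem strip_same {q r p : V} (e : q ⟶ r) {w : EdgePath r p} (a : G.A q) (t : G.Tuple w)
    (h : E.Reduced (.cons (e := e) a t)) :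
    E.strip e ⟨.cons e w, .cons a t, h⟩ =
      of (E.kernel r p) ⟨w, lmul (E.phi e a) t, E.reduced_lmul _ t h.2⟩ := by
  rw [strip, stripT, dif_pos rfl]

theorem strip_ne {q r r' p : V} {e : q ⟶ r} {f : q ⟶ r'} {w : EdgePath r' p} (a : G.A q)
    (t : G.Tuple w) (h : E.Reduced (.cons (e := f) a t))
    (hf : (⟨r', f⟩ : Σ x, q ⟶ x) ≠ ⟨r, e⟩) : E.strip e ⟨.cons f w, .cons a t, h⟩ = 0 := by
  rw [strip, stripT, dif_neg hf]

/-- The operator `u_e^p` on elementary tensors: it adds the edge `e` on the left; on words starting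
with `ē` and first letter `a`, this is done with the part `a - E_ē^s(a)`, and the part `E_ē^s(a)`
is moved through. -/
noncomputable def uMap {q r p : V} (e : q ⟶ r) (x : E.RWord r p) : KernelModule (E.kernel q p) :=
  of (E.kernel q p) (E.create e x) + E.strip (Quiver.reverse e) x

open SemiHilbertModule

theorem inner_of {q p : V} (x y : E.RWord q p) :
    inner (G.A p) (of (E.kernel q p) x) (of (E.kernel q p) y) = E.kern x y := inner_of_of x y

theorem inner_create {q r p : V} (e : q ⟶ r) (x : E.RWord r p) (y : E.RWord q p) :
    inner (G.A p) (of (E.kernel q p) (E.create e x)) (of (E.kernel q p) y) =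
      inner (G.A p) (of (E.kernel r p) x) (E.strip e y) := by
  obtain ⟨w', t', h'⟩ := y
  cases t' with
  | base a =>
    rw [strip_base, ip_zero_right, inner_of, kern_ne _ (fun h => by cases h)]
  | @cons _ r' _ f w' a t' =>
    by_cases hf : (⟨r', f⟩ : Σ x, q ⟶ x) = ⟨r, e⟩
    · obtain ⟨rfl, h2⟩ := Sigma.mk.inj hf
      obtain rfl := eq_of_heq h2
      rw [strip_same, inner_of, inner_of]
      obtain ⟨w, t, h⟩ := x
      by_cases hw : w = w'
      · subst hw
        rw [create_mk, kern_mk, kern_mk, form, form_proj _ _ _ _ _ h'.1, form_lmul_right, star_one,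
          one_mul, one_mul, one_mul]
      · rw [create_mk, kern_ne, kern_ne _ hw]
        intro h3
        cases h3
        exact hw rfl
    · obtain ⟨w, t, h⟩ := x
      rw [strip_ne _ _ _ _ hf, ip_zero_right, inner_of, create_mk, kern_ne]
      exact cons_ne _ _ hf

theorem uMap_adjoint {q r p : V} (e : q ⟶ r) (x : E.RWord r p) (y : E.RWord q p) :
    inner (G.A p) (E.uMap e x) (of (E.kernel q p) y) =
      inner (G.A p) (of (E.kernel r p) x) (E.uMap (Quiver.reverse e) y) := by
  rw [uMap, uMap, ip_add_left, ip_add_right, inner_create, Quiver.reverse_reverse, add_comm]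
  congr 1
  rw [← star_ip, ← inner_create, star_ip]

/-- Left multiplication on elementary tensors. -/
noncomputable def leftMap {q p : V} (a : G.A q) (x : E.RWord q p) : KernelModule (E.kernel q p) :=
  of (E.kernel q p) (E.lmulW a x)

theorem inner_left_left {q p : V} (a b : G.A q) (x y : E.RWord q p) :
    inner (G.A p) (E.leftMap a x) (E.leftMap b y) =
      inner (G.A p) (E.leftMap (star b * a) x) (of (E.kernel q p) y) := by
  rw [leftMap, leftMap, leftMap, inner_of, inner_of]
  obtain ⟨w, t, h⟩ := x
  obtain ⟨w', t', h'⟩ := y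
  rw [lmulW_mk, lmulW_mk, lmulW_mk]
  by_cases hw : w = w'
  · subst hw
    rw [kern_mk, kern_mk, form_lmul_right, form_lmul_left, form_lmul_left, star_mul, star_star]
    simp only [mul_one, one_mul]
  · rw [kern_ne _ hw, kern_ne _ hw]

theorem lmulW_one {q p : V} (x : E.RWord q p) : E.lmulW 1 x = x := by
  obtain ⟨w, t, h⟩ := x
  rw [lmulW_mk]
  simp only [one_lmul]

theorem lmulW_mul {q p : V} (a b : G.A q) (x : E.RWord q p) :
    E.lmulW (a * b) x = E.lmulW a (E.lmulW b x) := by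
  obtain ⟨w, t, h⟩ := x
  rw [lmulW_mk, lmulW_mk, lmulW_mk]
  simp only [mul_lmul]

theorem left_adjoint {q p : V} (a : G.A q) (x y : E.RWord q p) :
    inner (G.A p) (E.leftMap a x) (of (E.kernel q p) y) =
      inner (G.A p) (of (E.kernel q p) x) (E.leftMap (star a) y) := by
  have h := E.inner_left_left 1 (star a) x y
  rw [star_star, mul_one, leftMap, lmulW_one] at h
  rw [h]

theorem left_add {q p : V} (a b : G.A q) (x y : E.RWord q p) :
    inner (G.A p) (E.leftMap (a + b) x) (of (E.kernel q p) y) =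
      inner (G.A p) (E.leftMap a x) (of (E.kernel q p) y) +
        inner (G.A p) (E.leftMap b x) (of (E.kernel q p) y) := by
  rw [leftMap, leftMap, leftMap, inner_of, inner_of, inner_of]
  obtain ⟨w, t, h⟩ := x
  obtain ⟨w', t', h'⟩ := y
  rw [lmulW_mk, lmulW_mk, lmulW_mk]
  by_cases hw : w = w'
  · subst hw
    rw [kern_mk, kern_mk, kern_mk, form_lmul_left, form_lmul_left, form_lmul_left, star_add,
      add_mul, form_add]
  · rw [kern_ne _ hw, kern_ne _ hw, kern_ne _ hw, add_zero]

theorem left_smul {q p : V} (c : ℂ) (a : G.A q) (x y : E.RWord q p) :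
    inner (G.A p) (E.leftMap (c • a) x) (of (E.kernel q p) y) =
      star c • inner (G.A p) (E.leftMap a x) (of (E.kernel q p) y) := by
  rw [leftMap, leftMap, inner_of, inner_of]
  obtain ⟨w, t, h⟩ := x
  obtain ⟨w', t', h'⟩ := y
  rw [lmulW_mk, lmulW_mk]
  by_cases hw : w = w'
  · subst hw
    rw [kern_mk, kern_mk, form_lmul_left, form_lmul_left, star_smul, smul_mul_assoc, form_smul]
  · rw [kern_ne _ hw, kern_ne _ hw, smul_zero]

theorem phi_s_mul {p q : V} (e : p ⟶ q) (b : G.B e) (a : G.A p) :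
    E.phi e (G.s e b * a) = G.r e b * E.phi e a := by
  rw [phi_apply, phi_apply, eps_s_mul, map_mul]

theorem left_strip {q r p : V} (e : q ⟶ r) (b : G.B e) (x : E.RWord q p) :
    lift (E.leftMap (G.r e b)) (E.strip e x) = E.strip e (E.lmulW (G.s e b) x) := by
  obtain ⟨w, t, h⟩ := x
  rw [lmulW_mk]
  cases t with
  | base a =>
    simp only [lmul]
    rw [strip_base, strip_base, map_zero]
  | @cons _ r' _ f w a t =>
    simp only [lmul]
    by_cases hf : (⟨r', f⟩ : Σ x, q ⟶ x) = ⟨r, e⟩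
    · obtain ⟨rfl, h2⟩ := Sigma.mk.inj hf
      obtain rfl := eq_of_heq h2
      rw [strip_same, strip_same, lift_of, leftMap, lmulW_mk]
      simp only [phi_s_mul, mul_lmul]
    · rw [strip_ne _ _ _ _ hf, strip_ne _ _ _ _ hf, map_zero]

theorem strip_strip {q r p : V} (e : q ⟶ r) (x y : E.RWord r p) :
    inner (G.A p) (of (E.kernel q p) (E.create e x)) (E.strip (Quiver.reverse e) y) = 0 := by
  obtain ⟨w, t, h⟩ := y
  cases t with
  | base a => rw [strip_base, ip_zero_right]
  | @cons _ r' _ f w a t =>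
    by_cases hf : (⟨r', f⟩ : Σ x, r ⟶ x) = ⟨q, Quiver.reverse e⟩
    · obtain ⟨rfl, h2⟩ := Sigma.mk.inj hf
      obtain rfl := eq_of_heq h2
      rw [strip_same, inner_create]
      cases t with
      | base a' => simp only [lmul]; rw [strip_base, ip_zero_right]
      | @cons _ r'' _ g w a' t =>
        simp only [lmul]
        by_cases hg : (⟨r'', g⟩ : Σ x, r' ⟶ x) = ⟨r, e⟩
        · have h0 : E.E g a' = 0 := h.1 (by rw [IsBack, Quiver.reverse_reverse]; exact hg)
          obtain ⟨rfl, h2⟩ := Sigma.mk.inj hg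
          obtain rfl := eq_of_heq h2
          rw [strip_same, inner_of]
          have hz : E.phi g (E.phi (Quiver.reverse g) a * a') = 0 := by
            have hb := (G.flip g).apply_symm_apply (E.eps (Quiver.reverse g) a)
            rw [phi_apply E (Quiver.reverse g), ← hb, r_reverse, phi_s_mul, phi_apply,
              E.eps_eq_zero h0, map_zero, mul_zero]
          rw [hz]
          obtain ⟨v, u, hu⟩ := x
          by_cases hv : v = w
          · subst hv
            rw [kern_mk, form_lmul_right, mul_zero, form_zero]
          · rw [kern_ne _ hv]
        · rw [strip_ne _ _ _ _ hg, ip_zero_right]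
    · rw [strip_ne _ _ _ _ hf, ip_zero_right]

theorem proj_cons_back {q r p : V} (e : q ⟶ r) {w : EdgePath q p} (a : G.A r) (t : G.Tuple w) :
    E.projTuple e (.cons (e := Quiver.reverse e) a t) =
      .cons (a - (E.E (Quiver.reverse e) a : G.A r)) t := by
  have hb : IsBack e (Quiver.reverse e) := rfl
  rw [projTuple, if_pos hb]

/-- The part of a word removed by the projection is the part which is moved through. -/
theorem inner_strip_strip {q r p : V} (e : q ⟶ r) (y x : E.RWord r p) :
    inner (G.A p) (of (E.kernel r p) y)
        (of (E.kernel r p) ⟨x.path, E.projTuple e x.tuple, E.reduced_proj e _ x.reduced⟩) +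
      inner (G.A p) (E.strip (Quiver.reverse e) y) (E.strip (Quiver.reverse e) x) =
    inner (G.A p) (of (E.kernel r p) y) (of (E.kernel r p) x) := by
  obtain ⟨w, t, h⟩ := x
  cases t with
  | base a => rw [strip_base, ip_zero_right, add_zero]; rfl
  | @cons _ r' _ f w a t =>
    by_cases hf : (⟨r', f⟩ : Σ x, r ⟶ x) = ⟨q, Quiver.reverse e⟩
    · obtain ⟨rfl, h2⟩ := Sigma.mk.inj hf
      obtain rfl := eq_of_heq h2
      rw [strip_same]
      simp only [proj_cons_back]
      obtain ⟨v, u, hu⟩ := y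
      cases u with
      | base c =>
        rw [strip_base, ip_zero_left, add_zero, inner_of, inner_of,
          kern_ne _ (fun h => by cases h), kern_ne _ (fun h => by cases h)]
      | @cons _ r'' _ g v c u =>
        by_cases hg : (⟨r'', g⟩ : Σ x, r ⟶ x) = ⟨r', Quiver.reverse e⟩
        · obtain ⟨rfl, h2⟩ := Sigma.mk.inj hg
          obtain rfl := eq_of_heq h2
          rw [strip_same, inner_of, inner_of, inner_of]
          by_cases hv : v = w
          · subst hv
            rw [kern_mk, kern_mk, kern_mk, form, form, form_lmul_left, form_lmul_right, ← form_add]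
            congr 1
            rw [mul_one, mul_one, mul_sub, map_sub, ← s_eps, star_phi]
            have h1 : E.phi (Quiver.reverse e) (star c * G.s (Quiver.reverse e)
                (E.eps (Quiver.reverse e) a)) =
                E.phi (Quiver.reverse e) (star c) * E.phi (Quiver.reverse e) a := by
              rw [phi_apply, phi_apply, phi_apply, eps_mul_s, map_mul]
            rw [h1, sub_add_cancel]
          · have hv' : EdgePath.cons (Quiver.reverse e) v ≠ .cons (Quiver.reverse e) w := by
              intro h3
              cases h3
              exact hv rfl
            rw [kern_ne E (x := ⟨v, _, _⟩) (y := ⟨w, _, _⟩) hv, kern_ne _ hv', kern_ne _ hv',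
              add_zero]
        · rw [strip_ne _ _ _ _ hg, ip_zero_left, add_zero, inner_of, inner_of, kern_ne, kern_ne]
          all_goals exact (cons_ne _ _ hg).symm
    · rw [strip_ne _ _ _ _ hf, ip_zero_right, add_zero]
      simp only [projTuple]
      have hb : ¬ IsBack e f := hf
      simp only [if_neg hb]

theorem inner_uMap {q r p : V} (e : q ⟶ r) (y x : E.RWord r p) :
    inner (G.A p) (E.uMap e y) (E.uMap e x) =
      inner (G.A p) (of (E.kernel r p) y) (of (E.kernel r p) x) := by
  rw [uMap, uMap, ip_add_left, ip_add_right, ip_add_right, strip_strip, add_zero,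
    ← star_ip _ (E.strip _ y), strip_strip, star_zero, zero_add, inner_create,
    ← inner_strip_strip E e]
  congr 2
  obtain ⟨w, t, h⟩ := x
  rw [create_mk, strip_same]
  congr 2
  rw [phi_apply, ← map_one (G.s e), eps_s, map_one, one_lmul]

theorem left_uMap {q r p : V} (e : q ⟶ r) (b : G.B e) (x : E.RWord r p) (y : E.RWord q p) :
    inner (G.A p) (lift (E.leftMap (G.s e b)) (E.uMap e x)) (of (E.kernel q p) y) =
      inner (G.A p) (E.uMap e (E.lmulW (G.r e b) x)) (of (E.kernel q p) y) := by
  rw [uMap, uMap, map_add, ip_add_left, ip_add_left]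
  congr 1
  · rw [lift_of, left_adjoint, leftMap, inner_create, inner_create, ← map_star, ← left_strip,
      ← lift_adjoint (φ := E.leftMap (G.r e b)), lift_of, leftMap]
    intro x y
    rw [left_adjoint, map_star]
  · rw [r_apply, ← left_strip, r_reverse]

theorem norm_left_le {q p : V} (a : G.A q) (f : KernelModule (E.kernel q p)) :
    ‖lift (E.leftMap a) f‖ ≤ ‖a‖ * ‖f‖ := by
  obtain ⟨b, hb⟩ := IsPos.norm_sq_sub a
  refine norm_lift_le _ (E.leftMap b) _ (norm_nonneg a) (fun x y => ?_) f
  rw [inner_left_left, inner_left_left, ← left_add, hb, add_sub_cancel, left_smul, leftMap,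
    lmulW_one, RCLike.star_def, Complex.conj_ofReal]

/-- Left multiplication by `a ∈ A_q` on the Hilbert module `ℋ_{q,p} = ⨁_w ℋ_w`. -/
noncomputable def leftOp {q : V} (p : V) (a : G.A q) :
    Adjointable (G.A p) (Hilb (E.kernel q p)) (Hilb (E.kernel q p)) :=
  mkAdjointable (E.leftMap a) (E.leftMap (star a)) (E.left_adjoint a) ‖a‖
    (E.norm_left_le a) (fun g => (E.norm_left_le (star a) g).trans_eq (by rw [norm_star]))

theorem inner_leftOp {q p : V} (a : G.A q) (x y : E.RWord q p) :
    inner (G.A p) ((E.leftOp p a).toCLM (vec _ x)) (vec (E.kernel q p) y) =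
      inner (G.A p) (E.leftMap a x) (of _ y) :=
  inner_mkAdjointable _ _ _ _ _ _ x y

theorem leftOp_one (q p : V) : E.leftOp p (1 : G.A q) = 1 := by
  refine Adjointable.ext_vec fun x => eq_of_inner_vec fun y => ?_
  rw [inner_leftOp, leftMap, lmulW_one]
  exact (completion_inner_coe _ _).symm

theorem leftOp_mul {q : V} (p : V) (a b : G.A q) :
    E.leftOp p (a * b) = E.leftOp p a * E.leftOp p b := by
  refine Adjointable.ext_vec fun x => ?_
  rw [Adjointable.mul_apply, leftOp, leftOp, leftOp, mkAdjointable_vec, mkAdjointable_vec,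
    mkAdjointable_coe, leftMap, leftMap, lift_of, leftMap, lmulW_mul]

theorem leftOp_add {q : V} (p : V) (a b : G.A q) :
    E.leftOp p (a + b) = E.leftOp p a + E.leftOp p b := by
  refine Adjointable.ext_vec fun x => eq_of_inner_vec fun y => ?_
  rw [inner_leftOp, left_add, ← inner_leftOp, ← inner_leftOp]
  exact (ip_add_left ((E.leftOp p a).toCLM (vec _ x)) ((E.leftOp p b).toCLM (vec _ x))
    (vec (E.kernel q p) y)).symm

theorem leftOp_smul {q : V} (p : V) (c : ℂ) (a : G.A q) :
    E.leftOp p (c • a) = c • E.leftOp p a := by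
  refine Adjointable.ext_vec fun x => eq_of_inner_vec fun y => ?_
  rw [inner_leftOp, left_smul, ← inner_leftOp]
  exact (ip_smul_left c ((E.leftOp p a).toCLM (vec _ x)) (vec (E.kernel q p) y)).symm

theorem leftOp_star {q : V} (p : V) (a : G.A q) : E.leftOp p (star a) = star (E.leftOp p a) :=
  Adjointable.ext fun _ => rfl

/-- The left action of `A_q` on `ℋ_{q,p}`. -/
noncomputable def pathAction (q p : V) :
    G.A q →⋆ₐ[ℂ] Adjointable (G.A p) (Hilb (E.kernel q p)) (Hilb (E.kernel q p)) where
  toFun := E.leftOp p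
  map_one' := E.leftOp_one q p
  map_mul' := E.leftOp_mul p
  map_zero' := by rw [← zero_smul ℂ (0 : G.A q), leftOp_smul, zero_smul]
  map_add' := E.leftOp_add p
  commutes' c := by
    rw [Algebra.algebraMap_eq_smul_one, leftOp_smul, leftOp_one, Algebra.algebraMap_eq_smul_one]
  map_star' := E.leftOp_star p

theorem norm_uMap_le {q r p : V} (e : q ⟶ r) (f : KernelModule (E.kernel r p)) :
    ‖lift (E.uMap e) f‖ ≤ 1 * ‖f‖ := by
  refine norm_lift_le _ (fun _ => 0) _ zero_le_one (fun x y => ?_) f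
  rw [inner_uMap, ip_zero_left, add_zero, one_pow, Complex.ofReal_one, one_smul]

/-- The operator `u_e^p : ℋ_{r(e),p} → ℋ_{s(e),p}`. -/
noncomputable def pathUnitary {q r : V} (e : q ⟶ r) (p : V) :
    Adjointable (G.A p) (Hilb (E.kernel r p)) (Hilb (E.kernel q p)) :=
  mkAdjointable (E.uMap e) (E.uMap (Quiver.reverse e)) (E.uMap_adjoint e) 1 (E.norm_uMap_le e)
    (E.norm_uMap_le (Quiver.reverse e))

theorem pathUnitary_adj {q r : V} (e : q ⟶ r) (p : V) :
    (E.pathUnitary e p).adj = E.pathUnitary (Quiver.reverse e) p := Adjointable.ext fun _ => rfl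

theorem pathUnitary_adj_comp {q r : V} (e : q ⟶ r) (p : V) :
    (E.pathUnitary e p).adj.comp (E.pathUnitary e p) = Adjointable.id _ _ := by
  refine Adjointable.ext_vec fun x => eq_of_inner_vec fun y => ?_
  rw [Adjointable.comp_apply, Adjointable.inner_left]
  change inner _ _ ((E.pathUnitary e p).toCLM (vec _ y)) = _
  rw [pathUnitary, mkAdjointable_vec, mkAdjointable_vec]
  refine (completion_inner_coe _ _).trans ?_
  rw [inner_uMap]
  exact (completion_inner_coe _ _).symm

theorem pathUnitary_comp_adj {q r : V} (e : q ⟶ r) (p : V) :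
    (E.pathUnitary e p).comp (E.pathUnitary e p).adj = Adjointable.id _ _ := by
  have h := E.pathUnitary_adj_comp (Quiver.reverse e) p
  rwa [pathUnitary_adj, Quiver.reverse_reverse, ← pathUnitary_adj] at h

theorem pathUnitary_rel {q r : V} (e : q ⟶ r) (p : V) (b : G.B e) :
    (E.pathUnitary (Quiver.reverse e) p).comp
      ((E.pathAction q p (G.s e b)).comp (E.pathUnitary e p)) = E.pathAction r p (G.r e b) := by
  have h : (E.pathAction q p (G.s e b)).comp (E.pathUnitary e p) =
      (E.pathUnitary e p).comp (E.pathAction r p (G.r e b)) := by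
    refine Adjointable.ext_vec fun x => eq_of_inner_vec fun y => ?_
    rw [Adjointable.comp_apply, Adjointable.comp_apply]
    change inner _ ((E.leftOp p _).toCLM _) _ = inner _ ((E.pathUnitary e p).toCLM
      ((E.leftOp p _).toCLM _)) _
    rw [leftOp, leftOp, pathUnitary, mkAdjointable_vec, mkAdjointable_vec, mkAdjointable_coe,
      mkAdjointable_coe]
    refine (completion_inner_coe _ _).trans (Eq.trans ?_ (completion_inner_coe _ _).symm)
    rw [left_uMap, leftMap, lift_of]
  rw [h, ← pathUnitary_adj, ← Adjointable.comp_assoc, pathUnitary_adj_comp, Adjointable.id_comp]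

end Expectations

/-! ### Representations -/

variable (G) in
/-- Right Hilbert `D`-modules `K_p` with actions `π_p` of the vertex algebras and unitaries
`w_e : K_{r(e)} → K_{s(e)}` with `w_e* = w_ē` and `w_ē π_{s(e)}(s_e(b)) w_e = π_{r(e)}(r_e(b))`. -/
structure Rep (D : Type*) [CStarAlgebra D] where
  K : V → Type*
  [normed : ∀ p, NormedAddCommGroup (K p)]
  [space : ∀ p, NormedSpace ℂ (K p)]
  [right : ∀ p, Module Dᵐᵒᵖ (K p)]
  [hilbert : ∀ p, HilbertModule D (K p)]
  π : ∀ p, G.A p →⋆ₐ[ℂ] Adjointable D (K p) (K p)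
  w : ∀ {p q : V}, (p ⟶ q) → Adjointable D (K q) (K p)
  adj_comp {p q : V} (e : p ⟶ q) : (w e).adj.comp (w e) = Adjointable.id D (K q)
  comp_adj {p q : V} (e : p ⟶ q) : (w e).comp (w e).adj = Adjointable.id D (K p)
  w_adj {p q : V} (e : p ⟶ q) : (w e).adj = w (Quiver.reverse e)
  rel {p q : V} (e : p ⟶ q) (b : G.B e) :
    (w (Quiver.reverse e)).comp ((π p (G.s e b)).comp (w e)) = π q (G.r e b)

attribute [instance] Rep.normed Rep.space Rep.right Rep.hilbert

namespace Rep

variable {D : Type*} [CStarAlgebra D] (R : G.Rep D)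

/-- The operator `π(a₀) w_{e₁} π(a₁) ⋯ w_{eₙ} π(aₙ)`. -/
def op : ∀ {q p : V} {w : EdgePath q p}, G.Tuple w → Adjointable D (R.K p) (R.K q)
  | q, _, _, .base a => R.π q a
  | q, _, _, .cons (e := e) a t => (R.π q a).comp ((R.w e).comp (op t))

/-- The operator `w_{e₁} ⋯ w_{eₙ}`. -/
def path : ∀ {q p : V}, EdgePath q p → Adjointable D (R.K p) (R.K q)
  | q, _, .nil _ => Adjointable.id D (R.K q)
  | _, _, .cons e w => (R.w e).comp (path w)

theorem op_base {p : V} (a : G.A p) : R.op (.base a) = R.π p a := rfl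

theorem op_cons {q r p : V} {e : q ⟶ r} {w : EdgePath r p} (a : G.A q) (t : G.Tuple w) :
    R.op (.cons (e := e) a t) = (R.π q a).comp ((R.w e).comp (R.op t)) := rfl

theorem op_lmul : ∀ {q p : V} {w : EdgePath q p} (a : G.A q) (t : G.Tuple w),
    R.op (lmul a t) = (R.π q a).comp (R.op t)
  | q, _, _, a, .base b => by
    rw [lmul, op_base, op_base, map_mul]; rfl
  | q, _, _, a, .cons b t => by
    rw [lmul, op_cons, op_cons, map_mul]; rfl

theorem exists_comp : ∀ {q r p : V} {w₁ : EdgePath q r} {w₂ : EdgePath r p} (t₁ : G.Tuple w₁)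
    (t₂ : G.Tuple w₂), ∃ (w : EdgePath q p) (t : G.Tuple w), R.op t = (R.op t₁).comp (R.op t₂)
  | _, _, _, _, _, .base a, t₂ => ⟨_, lmul a t₂, R.op_lmul a t₂⟩
  | _, _, _, _, _, .cons (e := e) a t₁, t₂ => by
    obtain ⟨w, t, h⟩ := exists_comp t₁ t₂
    refine ⟨_, .cons (e := e) a t, ?_⟩
    rw [op_cons, h, op_cons]
    rfl

theorem exists_adj : ∀ {q p : V} {w₁ : EdgePath q p} (t₁ : G.Tuple w₁),
    ∃ (w : EdgePath p q) (t : G.Tuple w), R.op t = (R.op t₁).adj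
  | _, _, _, .base a => ⟨_, .base (star a), map_star (R.π _) a⟩
  | _, _, _, .cons (e := e) a t₁ => by
    obtain ⟨w, t, h⟩ := exists_adj t₁
    obtain ⟨w', t', h'⟩ := R.exists_comp t
      (.cons (e := Quiver.reverse e) (1 : G.A _) (.base (star a)))
    refine ⟨w', t', ?_⟩
    rw [h', h, op_cons, op_cons, op_base, map_one, map_star, ← w_adj]
    rfl

/-- The operators `π(a₀) w_{e₁} π(a₁) ⋯ w_{eₙ} π(aₙ)`, for all paths `(e₁, …, eₙ)`, `n ≥ 0`, from
`p₀` to `p₀`. -/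
def ops (p₀ : V) : Set (Adjointable D (R.K p₀) (R.K p₀)) :=
  {T | ∃ (w : EdgePath p₀ p₀) (t : G.Tuple w), R.op t = T}

/-- The linear span of the operators `π(a₀) w_{e₁} π(a₁) ⋯ w_{eₙ} π(aₙ)`. -/
noncomputable def span (p₀ : V) : StarSubalgebra ℂ (Adjointable D (R.K p₀) (R.K p₀)) where
  carrier := Submodule.span ℂ (R.ops p₀)
  add_mem' := Submodule.add_mem _
  algebraMap_mem' c := by
    rw [Algebra.algebraMap_eq_smul_one]
    exact Submodule.smul_mem _ _ (Submodule.subset_span ⟨_, .base 1, map_one (R.π p₀)⟩)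
  mul_mem' {S T} hS hT := by
    have h := Submodule.mul_mem_mul hS hT
    rw [Submodule.span_mul_span] at h
    refine Submodule.span_mono ?_ h
    rintro _ ⟨_, ⟨_, t₁, rfl⟩, _, ⟨_, t₂, rfl⟩, rfl⟩
    exact R.exists_comp t₁ t₂
  star_mem' {S} hS := by
    change star S ∈ Submodule.span ℂ (R.ops p₀)
    refine Submodule.span_induction (p := fun S _ => star S ∈ Submodule.span ℂ (R.ops p₀))
      ?_ ?_ ?_ ?_ hS
    · rintro _ ⟨_, t, rfl⟩
      exact Submodule.subset_span (R.exists_adj t)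
    · rw [star_zero]; exact Submodule.zero_mem _
    · intro S T _ _ hS hT
      rw [star_add]; exact Submodule.add_mem _ hS hT
    · intro c S _ hS
      rw [star_smul]; exact Submodule.smul_mem _ _ hS

/-- The closed linear span of `π_{p₀}(A_{p₀})` and the operators
`π(a₀) w_{e₁} π(a₁) ⋯ w_{eₙ} π(aₙ)`, where `(e₁, …, eₙ)` is a path from `p₀` to `p₀`. -/
noncomputable def closedSpan (p₀ : V) : StarSubalgebra ℂ (Adjointable D (R.K p₀) (R.K p₀)) :=
  (R.span p₀).topologicalClosure

theorem op_mem_closedSpan {p₀ : V} {w : EdgePath p₀ p₀} (t : G.Tuple w) :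
    R.op t ∈ R.closedSpan p₀ :=
  (R.span p₀).le_topologicalClosure (Submodule.subset_span ⟨w, t, rfl⟩)

/-- The operator `π(a₀) w_{e₁} π(a₁) ⋯ w_{eₙ} π(aₙ)` as an element of the closed linear span. -/
noncomputable def word {p₀ : V} {w : EdgePath p₀ p₀} (t : G.Tuple w) : R.closedSpan p₀ :=
  ⟨R.op t, R.op_mem_closedSpan t⟩

/-- `π_{p₀}` as a homomorphism to the closed linear span. -/
noncomputable def vertexHom (p₀ : V) : G.A p₀ →⋆ₐ[ℂ] R.closedSpan p₀ :=
  (R.π p₀).codRestrict _ fun a => R.op_mem_closedSpan (.base a)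

/-- The C*-algebra generated by the operators `w_z* π_q(a) w_w`, where `q` is a vertex, `a ∈ A_q`,
and `z`, `w` are paths from `q` to `p₀`. -/
noncomputable def generated (p₀ : V) : StarSubalgebra ℂ (Adjointable D (R.K p₀) (R.K p₀)) :=
  (StarAlgebra.adjoin ℂ {T | ∃ (q : V) (z w : EdgePath q p₀) (a : G.A q),
    T = (R.path z).adj.comp ((R.π q a).comp (R.path w))}).topologicalClosure

theorem path_comp_adj : ∀ {q p : V} (w : EdgePath q p),
    (R.path w).comp (R.path w).adj = Adjointable.id D (R.K q)
  | _, _, .nil _ => rfl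
  | _, _, .cons e w => by
    change (R.w e).comp (((R.path w).comp (R.path w).adj).comp (R.w e).adj) = _
    rw [path_comp_adj w, Adjointable.id_comp, R.comp_adj]

theorem path_op_mem : ∀ {q p : V} {w : EdgePath q p} (t : G.Tuple w) (z : EdgePath q p),
    (R.path z).adj.comp (R.op t) ∈ R.generated p
  | _, p, _, .base a, z => by
    refine StarSubalgebra.le_topologicalClosure _ (StarAlgebra.subset_adjoin ℂ _ ?_)
    exact ⟨_, z, .nil p, a, rfl⟩
  | _, p, _, .cons (e := e) a t, z => by
    have h := path_op_mem t (.cons (Quiver.reverse e) z)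
    have h' : (R.path z).adj.comp ((R.π _ a).comp (R.path z)) ∈ R.generated p :=
      StarSubalgebra.le_topologicalClosure _ (StarAlgebra.subset_adjoin ℂ _ ⟨_, z, z, a, rfl⟩)
    have e1 : (R.path z).adj.comp (R.op (.cons (e := e) a t)) =
        (R.path z).adj.comp ((R.π _ a).comp (R.path z)) *
          (R.path (.cons (Quiver.reverse e) z)).adj.comp (R.op t) := by
      change _ = (R.path z).adj.comp ((R.π _ a).comp (((R.path z).comp (R.path z).adj).comp
        ((R.w (Quiver.reverse e)).adj.comp (R.op t))))
      rw [path_comp_adj, Adjointable.id_comp, R.w_adj, Quiver.reverse_reverse]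
      rfl
    rw [e1]
    exact mul_mem h' h

theorem op_mem_generated {p : V} {w : EdgePath p p} (t : G.Tuple w) : R.op t ∈ R.generated p :=
  R.path_op_mem t (.nil p)

end Rep

namespace Expectations

variable (E : G.Expectations)

/-- The representation on the path Hilbert modules `ℋ_{q,p}`, with `w_e = u_e^p`. -/
noncomputable def pathRep (p : V) : G.Rep (G.A p) where
  K q := KernelModule.Hilb (E.kernel q p)
  π q := E.pathAction q p
  w e := E.pathUnitary e p
  adj_comp e := E.pathUnitary_adj_comp e p
  comp_adj e := E.pathUnitary_comp_adj e p
  w_adj e := E.pathUnitary_adj e p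
  rel e := E.pathUnitary_rel e p

/-- The reduced fundamental C*-algebra `P(p₀) = π₁^{p₀}(𝒢, (A_q), (B_e), p₀)`. -/
noncomputable def P (p₀ : V) :
    StarSubalgebra ℂ (Adjointable (G.A p₀) ((E.pathRep p₀).K p₀) ((E.pathRep p₀).K p₀)) :=
  (E.pathRep p₀).generated p₀

/-- The operator `a₀ u_{e₁} a₁ ⋯ u_{eₙ} aₙ ∈ P(p₀)`. -/
noncomputable def word {p₀ : V} {w : EdgePath p₀ p₀} (t : G.Tuple w) : E.P p₀ :=
  ⟨(E.pathRep p₀).op t, (E.pathRep p₀).op_mem_generated t⟩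

end Expectations

end GraphOfCStarAlgebras

end GraphCStar

/-!
The isomorphism is obtained from its graph. Let `Γ ⊆ A × P(p₀)`, with `A = R.closedSpan p₀`, be
the closure of the linear span of the pairs `(R.word t, E.word t)`, where `t` runs over all words
from `p₀` to `p₀`, reduced or not. Products and adjoints of words are computed by the same
formulas in every representation, so `Γ` is a C*-algebra. Its coordinate projections are
*-homomorphisms to `A` and `P(p₀)` with dense ranges. If both are injective they are isometric,
hence onto, and `Γ` is the graph of a *-isomorphism (`exists_starAlgEquiv_of_graph`).

Injectivity comes from comparing the given expectation `F` on `A` with the vacuum expectation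
`x ↦ ⟨Ω, x Ω⟩` on `P(p₀)`, where `Ω ∈ ℋ_{p₀,p₀}` is the word `1` of length zero: `F(a) = π(⟨Ω, b Ω⟩)`
for all `(a, b) ∈ Γ` (`expectation_eq_of_mem_closure`). By continuity it is enough to see this for
words. The splitting `a = (a - E_ē(a)) + E_ē(a)` and the relation between `w_e` and the vertex
algebras write the operator of a word as a combination of operators of reduced words, with the
same coefficients in both representations (`Rep.op_mem_reducedSpan`). On reduced words of positive
length both sides vanish, and on words of length zero they agree.

Now let `(a, b) ∈ Γ`. If `b = 0`, then `F((ay)*(ay)) = 0` for all first coordinates `y` of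
elements of `Γ`, which are dense in `A`, so `a = 0` since `F` is GNS-faithful. If `a = 0`, then
`b y Ω = 0` for all words `y`; a reduced operator maps `Ω` to the elementary tensor of its word
(`Expectations.op_vacuum`), so `Ω` is cyclic for `P(p₀)` and `b = 0`.

Uniqueness holds because reduced words span all words, which span a dense subspace of `P(p₀)`.
-/

open GraphCStar GraphCStar.GraphOfCStarAlgebras

namespace GraphCStar

/-! ### C*-algebras and dense subspaces -/

/-- The closed *-subalgebra `S` of `A × B` is the graph of an isomorphism: both coordinate
projections are injective on `S`, hence isometric, so that their dense ranges are closed. -/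
theorem exists_starAlgEquiv_of_graph {A B : Type*} [CStarAlgebra A] [CStarAlgebra B]
    (S : StarSubalgebra ℂ (A × B)) (hS : IsClosed (S : Set (A × B)))
    (hA : Dense (Prod.fst '' (S : Set (A × B)))) (hB : Dense (Prod.snd '' (S : Set (A × B))))
    (h₁ : ∀ b, ((0, b) : A × B) ∈ S → b = 0) (h₂ : ∀ a, ((a, 0) : A × B) ∈ S → a = 0) :
    ∃ Φ : B ≃⋆ₐ[ℂ] A, ∀ x ∈ S, Φ x.2 = x.1 := by
  -- makes `S` a C*-algebra
  have := hS
  let f : S →⋆ₐ[ℂ] A := (StarAlgHom.fst ℂ A B).comp S.subtype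
  let g : S →⋆ₐ[ℂ] B := (StarAlgHom.snd ℂ A B).comp S.subtype
  have hf : Function.Injective f := (injective_iff_map_eq_zero f).mpr fun x hx => by
    obtain ⟨⟨a, b⟩, hx'⟩ := x
    obtain rfl : a = 0 := hx
    obtain rfl := h₁ b hx'
    rfl
  have hg : Function.Injective g := (injective_iff_map_eq_zero g).mpr fun x hx => by
    obtain ⟨⟨a, b⟩, hx'⟩ := x
    obtain rfl : b = 0 := hx
    obtain rfl := h₂ a hx'
    rfl
  have hf' : Function.Surjective f := by
    rw [← Set.range_eq_univ,
      ← (NonUnitalStarAlgHom.isometry f hf).isClosedEmbedding.isClosed_range.closure_eq]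
    refine (hA.mono ?_).closure_eq
    rintro _ ⟨x, hx, rfl⟩
    exact ⟨⟨x, hx⟩, rfl⟩
  have hg' : Function.Surjective g := by
    rw [← Set.range_eq_univ,
      ← (NonUnitalStarAlgHom.isometry g hg).isClosedEmbedding.isClosed_range.closure_eq]
    refine (hB.mono ?_).closure_eq
    rintro _ ⟨x, hx, rfl⟩
    exact ⟨⟨x, hx⟩, rfl⟩
  refine ⟨(StarAlgEquiv.ofBijective g ⟨hg, hg'⟩).symm.trans (StarAlgEquiv.ofBijective f ⟨hf, hf'⟩),
    fun x hx => ?_⟩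
  have : (StarAlgEquiv.ofBijective g ⟨hg, hg'⟩).symm x.2 = ⟨x, hx⟩ := by
    rw [StarAlgEquiv.symm_apply_eq]
    rfl
  change StarAlgEquiv.ofBijective f ⟨hf, hf'⟩ ((StarAlgEquiv.ofBijective g ⟨hg, hg'⟩).symm x.2) = _
  rw [this]
  rfl

/-- The *-algebra generated by a set closed under products and adjoints is its linear span. -/
theorem mem_adjoin_iff_mem_span {A : Type*} [Ring A] [StarRing A] [Algebra ℂ A] [StarModule ℂ A]
    {T : Set A} (h1 : 1 ∈ T) (hm : ∀ x ∈ T, ∀ y ∈ T, x * y ∈ T) (hs : ∀ x ∈ T, star x ∈ T) (x : A) :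
    x ∈ StarAlgebra.adjoin ℂ T ↔ x ∈ Submodule.span ℂ T := by
  let M : Submonoid A := { carrier := T, one_mem' := h1, mul_mem' := fun hx hy => hm _ hx _ hy }
  have e1 : T ∪ star T = T := Set.union_eq_self_of_subset_right fun y hy => by
    simpa using hs _ hy
  have e2 : (Submonoid.closure T : Set A) = T := congrArg SetLike.coe (Submonoid.closure_eq M)
  have h := StarAlgebra.adjoin_eq_span (R := ℂ) T
  rw [e1, e2] at h
  rw [← h]
  rfl

theorem dense_span_of_subset_closure {A : Type*} [NormedRing A] [StarRing A] [NormedAlgebra ℂ A]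
    [StarModule ℂ A] (C : StarSubalgebra ℂ A) (T : Set C)
    (h : (C : Set A) ⊆ closure (Submodule.span ℂ ((↑) '' T : Set A))) :
    Dense (Submodule.span ℂ T : Set C) := by
  intro x
  rw [closure_subtype]
  have e : Submodule.span ℂ ((↑) '' T : Set A) =
      (Submodule.span ℂ T).map C.subtype.toAlgHom.toLinearMap := by
    rw [Submodule.map_span]; rfl
  have := h x.2
  rw [e] at this
  exact this

/-- Conditional expectations on C*-algebras are contractive. The target is not assumed to be closed,
so the estimates are made in the ambient algebra. -/
theorem ConditionalExpectation.norm_map_le {A : Type*} [CStarAlgebra A] {D : StarSubalgebra ℂ A}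
    (F : ConditionalExpectation D) (x : A) : ‖F x‖ ≤ ‖x‖ := by
  have pos : ∀ y : A, IsPos (F (star y * y) : A) := fun y => by
    obtain ⟨b, hb⟩ := F.map_pos y
    exact ⟨b, by rw [hb]; rfl⟩
  have F1 : F 1 = 1 := F.map_coe 1
  -- `F(x)* F(x) ≤ F(x* x)`, from the positivity of `F` at `x - F(x)`.
  have h1 : ‖(F x : A)‖ ^ 2 ≤ ‖(F (star x * x) : A)‖ := by
    rw [sq, ← CStarRing.norm_star_mul_self]
    refine IsPos.norm_le ⟨_, rfl⟩ ?_
    have := pos (x - F x)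
    convert this using 1
    have e : star (x - (F x : A)) * (x - (F x : A)) =
        star x * x - star x * (F x : A) - ((star (F x) : D) : A) * x +
          ((star (F x) * F x : D) : A) := by
      rw [star_sub]
      simp only [MulMemClass.coe_mul, StarMemClass.coe_star]
      noncomm_ring
    rw [e, map_add, map_sub, map_sub, F.map_mul_right, F.map_mul_left, F.map_coe, ← F.star_map]
    simp
  -- `F(x* x) ≤ ‖x‖²`
  have h2 : ‖(F (star x * x) : A)‖ ≤ ‖x‖ ^ 2 := by
    obtain ⟨b, hb⟩ := IsPos.norm_sq_sub x
    have h := pos b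
    rw [hb, map_sub, map_smul, F1] at h
    refine ((pos x).norm_le h).trans ?_
    cases subsingleton_or_nontrivial A
    · exact (norm_of_subsingleton _).trans_le (sq_nonneg ‖x‖)
    · change ‖((‖x‖ ^ 2 : ℝ) : ℂ) • (1 : A)‖ ≤ _
      rw [norm_smul, CStarRing.norm_one, mul_one, Complex.norm_real,
        Real.norm_of_nonneg (by positivity)]
  exact (pow_le_pow_iff_left₀ (norm_nonneg _) (norm_nonneg _) two_ne_zero).mp (h1.trans h2)

theorem ConditionalExpectation.continuous {A : Type*} [CStarAlgebra A] {D : StarSubalgebra ℂ A}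
    (F : ConditionalExpectation D) : Continuous F :=
  (F.toLinearMap.mkContinuous 1 fun x => by rw [one_mul]; exact F.norm_map_le x).continuous

/-- The functional `T ↦ ⟨x, T x⟩`. -/
noncomputable def Adjointable.vectorFunctional {A E : Type*} [CStarAlgebra A]
    [NormedAddCommGroup E] [NormedSpace ℂ E] [Module Aᵐᵒᵖ E] [HilbertModule A E] (x : E) :
    Adjointable A E E →L[ℂ] A :=
  LinearMap.mkContinuous
    { toFun := fun T => inner A x (T.toCLM x)
      map_add' := fun S T => SemiHilbertModule.ip_add_right x (S.toCLM x) (T.toCLM x)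
      map_smul' := fun c T => SemiHilbertModule.ip_smul_right c x (T.toCLM x) }
    (‖x‖ * ‖x‖) fun T => by
      refine (SemiHilbertModule.norm_ip_le x (T.toCLM x)).trans ?_
      rw [mul_assoc, mul_comm ‖x‖ ‖T‖]
      exact mul_le_mul_of_nonneg_left (T.toCLM.le_opNorm x) (norm_nonneg _)

namespace GraphOfCStarAlgebras

variable {V : Type u₁} [Quiver.{u₂} V] [Quiver.HasInvolutiveReverse V]
  {G : GraphOfCStarAlgebras.{u₁, u₂, u₃, u₄} V}

namespace Rep

variable {D D' : Type*} [CStarAlgebra D] [CStarAlgebra D'] (R : G.Rep D) (S : G.Rep D')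

/-! ### Products and adjoints of words -/

/-- The product of two words is a word, and the same one in both representations. -/
theorem exists_comp_pair : ∀ {q r p : V} {w₁ : EdgePath q r} {w₂ : EdgePath r p}
    (t₁ : G.Tuple w₁) (t₂ : G.Tuple w₂), ∃ (w : EdgePath q p) (t : G.Tuple w),
      R.op t = (R.op t₁).comp (R.op t₂) ∧ S.op t = (S.op t₁).comp (S.op t₂)
  | _, _, _, _, _, .base a, t₂ => ⟨_, lmul a t₂, R.op_lmul a t₂, S.op_lmul a t₂⟩
  | _, _, _, _, _, .cons (e := e) a t₁, t₂ => by
    obtain ⟨w, t, h, h'⟩ := exists_comp_pair t₁ t₂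
    refine ⟨_, .cons (e := e) a t, ?_, ?_⟩
    · rw [op_cons, h, op_cons]; rfl
    · rw [op_cons, h', op_cons]; rfl

theorem exists_adj_pair : ∀ {q p : V} {w₁ : EdgePath q p} (t₁ : G.Tuple w₁),
    ∃ (w : EdgePath p q) (t : G.Tuple w), R.op t = (R.op t₁).adj ∧ S.op t = (S.op t₁).adj
  | _, _, _, .base a => ⟨_, .base (star a), map_star (R.π _) a, map_star (S.π _) a⟩
  | _, _, _, .cons (e := e) a t₁ => by
    obtain ⟨w, t, h₁, h₂⟩ := exists_adj_pair t₁
    obtain ⟨w', t', h₁', h₂'⟩ := R.exists_comp_pair S t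
      (.cons (e := Quiver.reverse e) (1 : G.A _) (.base (star a)))
    refine ⟨w', t', ?_, ?_⟩
    · rw [h₁', h₁, op_cons, op_cons, op_base, map_one, map_star, ← w_adj]; rfl
    · rw [h₂', h₂, op_cons, op_cons, op_base, map_one, map_star, ← w_adj]; rfl

theorem exists_op_eq_path : ∀ {q p : V} (z : EdgePath q p),
    ∃ t : G.Tuple z, R.op t = R.path z
  | _, _, .nil _ => ⟨.base 1, map_one (R.π _)⟩
  | _, _, .cons e z => by
    obtain ⟨t, h⟩ := exists_op_eq_path z
    refine ⟨.cons 1 t, ?_⟩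
    rw [op_cons, map_one, h]; rfl

theorem generated_eq_closedSpan (p₀ : V) : R.generated p₀ = R.closedSpan p₀ := by
  refine le_antisymm ?_ ?_
  · refine StarSubalgebra.topologicalClosure_minimal (StarAlgebra.adjoin_le ?_)
      (StarSubalgebra.isClosed_topologicalClosure _)
    rintro _ ⟨q, z, w, a, rfl⟩
    obtain ⟨tz, hz⟩ := R.exists_op_eq_path z
    obtain ⟨tw, hw⟩ := R.exists_op_eq_path w
    obtain ⟨_, t, ht⟩ := R.exists_adj tz
    obtain ⟨_, t', ht'⟩ := R.exists_comp t (lmul a tw)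
    have := R.op_mem_closedSpan t'
    rwa [ht', ht, hz, op_lmul, hw] at this
  · refine StarSubalgebra.topologicalClosure_minimal ?_
      (StarSubalgebra.isClosed_topologicalClosure _)
    intro T hT
    have hle : Submodule.span ℂ (R.ops p₀) ≤
        Subalgebra.toSubmodule (R.generated p₀).toSubalgebra := by
      refine Submodule.span_le.mpr ?_
      rintro _ ⟨w, t, rfl⟩
      exact R.op_mem_generated t
    exact hle hT

/-! ### Every word is a combination of reduced words -/

theorem rel_reverse {p q : V} (e : p ⟶ q) (b : G.B (Quiver.reverse e)) :
    (R.w e).comp ((R.π q (G.s (Quiver.reverse e) b)).comp (R.w (Quiver.reverse e))) =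
      R.π p (G.r (Quiver.reverse e) b) := by
  have h := R.rel (Quiver.reverse e) b
  rwa [Quiver.reverse_reverse e] at h

variable (E : G.Expectations)

theorem w_op_of_not_isBack {q r r' p : V} (e : q ⟶ r) (f : r ⟶ r') {w : EdgePath r' p} (a : G.A r)
    (t : G.Tuple w) (h : ¬ IsBack e f) :
    (R.w e).comp (R.op (.cons (e := f) a t)) =
      R.op (.cons (e := e) 1 (E.projTuple e (.cons (e := f) a t))) := by
  rw [Expectations.projTuple, if_neg h, op_cons (e := e), map_one]
  rfl

/-- Splitting `a = (a - E_ē(a)) + E_ē(a)` in `w_e π(a) w_ē ⋯`, the second part is moved through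
`w_ē`. -/
theorem w_op_reverse {q r p : V} (e : q ⟶ r) {w : EdgePath q p} (a : G.A r) (t : G.Tuple w) :
    ((R.w e).comp (R.op (.cons (e := Quiver.reverse e) a t))).toCLM =
      (R.op (.cons (e := e) 1 (E.projTuple e (.cons (e := Quiver.reverse e) a t)))).toCLM +
        (R.op (lmul (E.phi (Quiver.reverse e) a) t)).toCLM := by
  rw [Expectations.proj_cons_back, op_cons (e := e), map_one, op_cons, op_cons, op_lmul,
    Expectations.phi_apply, ← rel_reverse, E.s_eps]
  ext x
  have h : (R.π r a).toCLM = (R.π r (a - (E.E (Quiver.reverse e) a : G.A r))).toCLM +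
      (R.π r (E.E (Quiver.reverse e) a : G.A r)).toCLM := by
    change _ = (R.π r _ + R.π r _).toCLM
    rw [← map_add, sub_add_cancel]
  change (R.w e).toCLM ((R.π r a).toCLM _) = (R.w e).toCLM ((R.π r _).toCLM _) +
    (R.w e).toCLM ((R.π r _).toCLM _)
  rw [h, ← map_add]
  rfl

/-- The span of the pairs of operators given by reduced words from `q` to `p` in two
representations. Bounded operators are used because operators between different modules are added
here. -/
def reducedSpan (q p : V) :
    Submodule ℂ ((R.K p →L[ℂ] R.K q) × (S.K p →L[ℂ] S.K q)) :=
  Submodule.span ℂ {x | ∃ (w : EdgePath q p) (t : G.Tuple w), E.Reduced t ∧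
    x = ((R.op t).toCLM, (S.op t).toCLM)}

theorem mem_reducedSpan {q p : V} {w : EdgePath q p} {t : G.Tuple w} (h : E.Reduced t) :
    ((R.op t).toCLM, (S.op t).toCLM) ∈ R.reducedSpan S E q p :=
  Submodule.subset_span ⟨w, t, h, rfl⟩

theorem comp_mem_reducedSpan {q q' p : V} (T : R.K q →L[ℂ] R.K q') (T' : S.K q →L[ℂ] S.K q')
    (h : ∀ (w : EdgePath q p) (t : G.Tuple w), E.Reduced t →
      (T.comp (R.op t).toCLM, T'.comp (S.op t).toCLM) ∈ R.reducedSpan S E q' p)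
    {x : (R.K p →L[ℂ] R.K q) × (S.K p →L[ℂ] S.K q)} (hx : x ∈ R.reducedSpan S E q p) :
    (T.comp x.1, T'.comp x.2) ∈ R.reducedSpan S E q' p := by
  induction hx using Submodule.span_induction with
  | mem x hx => obtain ⟨w, t, ht, rfl⟩ := hx; exact h w t ht
  | zero =>
    convert Submodule.zero_mem (R.reducedSpan S E q' p) using 1
    simp
  | add x y _ _ hx hy =>
    convert Submodule.add_mem _ hx hy using 1
    simp
  | smul c x _ hx =>
    convert Submodule.smul_mem _ c hx using 1
    simp

theorem w_comp_mem_reducedSpan {q r p : V} (e : q ⟶ r) {w : EdgePath r p} (t : G.Tuple w)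
    (h : E.Reduced t) :
    ((R.w e).toCLM.comp (R.op t).toCLM, (S.w e).toCLM.comp (S.op t).toCLM) ∈
      R.reducedSpan S E q p := by
  have hp : E.Reduced (.cons (e := e) 1 (E.projTuple e t)) :=
    E.reduced_cons (E.startReduced_proj e t) (E.reduced_proj e t h)
  have hmem := R.mem_reducedSpan S E hp
  change (((R.w e).comp (R.op t)).toCLM, ((S.w e).comp (S.op t)).toCLM) ∈ _
  cases t with
  | base a =>
    rw [op_cons, op_cons, map_one, map_one] at hmem
    exact hmem
  | @cons _ r' _ f w a t =>
    by_cases hf : IsBack e f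
    · obtain ⟨rfl, h2⟩ := Sigma.mk.inj hf
      obtain rfl := eq_of_heq h2
      rw [R.w_op_reverse E, S.w_op_reverse E]
      exact Submodule.add_mem _ hmem (R.mem_reducedSpan S E (E.reduced_lmul _ t h.2))
    · rw [R.w_op_of_not_isBack E _ _ _ _ hf, S.w_op_of_not_isBack E _ _ _ _ hf]
      exact hmem

theorem op_mem_reducedSpan : ∀ {q p : V} {w : EdgePath q p} (t : G.Tuple w),
    ((R.op t).toCLM, (S.op t).toCLM) ∈ R.reducedSpan S E q p
  | _, _, _, .base a => R.mem_reducedSpan S E (t := .base a) trivial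
  | _, _, _, .cons (e := e) a t => by
    refine R.comp_mem_reducedSpan S E (R.π _ a).toCLM (S.π _ a).toCLM (fun w t' ht' => ?_)
      (R.comp_mem_reducedSpan S E (R.w e).toCLM (S.w e).toCLM
        (fun w t' ht' => R.w_comp_mem_reducedSpan S E e t' ht') (op_mem_reducedSpan t))
    have := R.mem_reducedSpan S E (E.reduced_lmul a t' ht')
    rwa [op_lmul, op_lmul] at this

end Rep

namespace Expectations

open KernelModule SemiHilbertModule

variable (E : G.Expectations)

/-! ### The vacuum vector -/

theorem reduced_base {p : V} (a : G.A p) : E.Reduced (.base a) := trivial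

/-- The vector of `ℋ_{p,p}` given by the word `1` of length zero. -/
noncomputable def vacuum (p : V) : (E.pathRep p).K p :=
  vec (E.kernel p p) ⟨.nil p, .base 1, E.reduced_base 1⟩

/-- On a word that stays reduced after `e` is added, `u_e` only adds `e`. Here `strip` gives a word
with first letter zero, which is a null vector. -/
theorem inner_uMap_of_startReduced {q r p : V} (e : q ⟶ r) {w : EdgePath r p} (t : G.Tuple w)
    (h : E.Reduced t) (hs : E.StartReduced e t) (y : E.RWord q p) :
    inner (G.A p) (E.uMap e ⟨w, t, h⟩) (of (E.kernel q p) y) =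
      inner (G.A p) (of (E.kernel q p) ⟨.cons e w, .cons 1 t, E.reduced_cons hs h⟩)
        (of (E.kernel q p) y) := by
  rw [uMap, ip_add_left, create_mk]
  cases t with
  | base a => rw [strip_base, ip_zero_left, add_zero]; rfl
  | @cons _ r' _ f w a t =>
    by_cases hf : IsBack e f
    · have h0 := hs hf
      obtain ⟨rfl, h2⟩ := Sigma.mk.inj hf
      obtain rfl := eq_of_heq h2
      have hz : inner (G.A p) (E.strip (Quiver.reverse e) ⟨_, .cons a t, h⟩)
          (of (E.kernel r' p) y) = 0 := by
        rw [strip_same, inner_of, phi_apply, E.eps_eq_zero h0, map_zero]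
        obtain ⟨v, u, hu⟩ := y
        by_cases hv : w = v
        · subst hv
          rw [kern_mk, form_lmul_left, star_zero, zero_mul, form_zero]
        · rw [kern_ne _ hv]
      rw [hz, add_zero]
      simp only [proj_cons_back, h0, ZeroMemClass.coe_zero, sub_zero]
    · rw [strip_ne _ _ _ _ hf, ip_zero_left, add_zero]
      simp only [projTuple, if_neg hf]

/-- A reduced operator maps the vacuum vector to the elementary tensor of its word. -/
theorem op_vacuum : ∀ {q p : V} {w : EdgePath q p} (t : G.Tuple w) (h : E.Reduced t),
    ((E.pathRep p).op t).toCLM (E.vacuum p) = vec (E.kernel q p) ⟨w, t, h⟩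
  | p, _, _, .base a, h => by
    change (E.leftOp p a).toCLM (vec (E.kernel p p) _) = _
    rw [leftOp, mkAdjointable_vec, leftMap, lmulW_mk]
    simp only [lmul, mul_one]
    rfl
  | q, p, _, .cons (e := e) a t, h => by
    have ih := op_vacuum t h.2
    change (E.leftOp p a).toCLM ((E.pathUnitary e p).toCLM
      (((E.pathRep p).op t).toCLM (E.vacuum p))) = _
    have hu : (E.pathUnitary e p).toCLM (vec (E.kernel _ p) ⟨_, t, h.2⟩) =
        vec (E.kernel q p) ⟨_, .cons (e := e) 1 t, E.reduced_cons h.1 h.2⟩ := by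
      refine eq_of_inner_vec fun y => ?_
      rw [pathUnitary, mkAdjointable_vec]
      refine (completion_inner_coe _ _).trans (Eq.trans ?_ (completion_inner_coe _ _).symm)
      exact E.inner_uMap_of_startReduced e t h.2 h.1 y
    rw [ih, hu, leftOp, mkAdjointable_vec, leftMap, lmulW_mk]
    simp only [lmul, mul_one]
    rfl

theorem vacuum_expectation_base {p : V} (a : G.A p) :
    inner (G.A p) (E.vacuum p) (((E.pathRep p).op (.base a)).toCLM (E.vacuum p)) = a := by
  rw [E.op_vacuum (.base a) (E.reduced_base a)]
  refine (inner_vec _ _).trans ?_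
  change E.kern _ _ = _
  rw [kern_mk]
  simp [form]

theorem vacuum_expectation_eq_zero {p : V} {w : EdgePath p p} (t : G.Tuple w) (h : E.Reduced t)
    (hw : 0 < w.length) :
    inner (G.A p) (E.vacuum p) (((E.pathRep p).op t).toCLM (E.vacuum p)) = 0 := by
  rw [E.op_vacuum t h]
  refine (inner_vec _ _).trans ?_
  change E.kern _ _ = _
  rw [kern_ne]
  rintro rfl
  exact absurd hw (lt_irrefl _)

end Expectations

/-! ### The algebra of pairs -/

variable (E : G.Expectations) {p₀ : V}

/-- With this, `R.closedSpan p` is a C*-algebra. -/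
local instance isClosed_closedSpan (D : Type*) [CStarAlgebra D] (R : G.Rep D) (p : V) :
    IsClosed (R.closedSpan p : Set (Adjointable D (R.K p) (R.K p))) :=
  StarSubalgebra.isClosed_topologicalClosure _

local instance isClosed_P (p : V) : IsClosed (SetLike.coe (E.P p)) :=
  StarSubalgebra.isClosed_topologicalClosure _

variable {D : Type*} [CStarAlgebra D] (R : G.Rep D)

/-- The pair of operators given by a word from `p₀` to `p₀`. -/
noncomputable def wordPair {w : EdgePath p₀ p₀} (t : G.Tuple w) : R.closedSpan p₀ × E.P p₀ :=
  (R.word t, E.word t)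

variable (p₀) in
/-- The pairs of operators given by all words from `p₀` to `p₀`. -/
def wordPairs : Set (R.closedSpan p₀ × E.P p₀) :=
  {x | ∃ (w : EdgePath p₀ p₀) (t : G.Tuple w), wordPair E R t = x}

theorem wordPair_mem_span_reduced {w : EdgePath p₀ p₀} (t : G.Tuple w) :
    wordPair E R t ∈ Submodule.span ℂ
      {x | ∃ (w : EdgePath p₀ p₀) (t : G.Tuple w), E.Reduced t ∧ wordPair E R t = x} := by
  let L : R.closedSpan p₀ × E.P p₀ →ₗ[ℂ] (R.K p₀ →L[ℂ] R.K p₀) ×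
      ((E.pathRep p₀).K p₀ →L[ℂ] (E.pathRep p₀).K p₀) :=
    { toFun := fun x => (x.1.1.toCLM, x.2.1.toCLM)
      map_add' := fun _ _ => rfl
      map_smul' := fun _ _ => rfl }
  have hL : Function.Injective L := fun x y h => Prod.ext
    (Subtype.ext (Adjointable.toCLM_injective (congrArg Prod.fst h)))
    (Subtype.ext (Adjointable.toCLM_injective (congrArg Prod.snd h)))
  have h := R.op_mem_reducedSpan (E.pathRep p₀) E t
  have hle : R.reducedSpan (E.pathRep p₀) E p₀ p₀ ≤ (Submodule.span ℂ
      {x | ∃ (w : EdgePath p₀ p₀) (t : G.Tuple w), E.Reduced t ∧ wordPair E R t = x}).map L := by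
    refine Submodule.span_le.mpr ?_
    rintro _ ⟨w, t, ht, rfl⟩
    exact ⟨wordPair E R t, Submodule.subset_span ⟨w, t, ht, rfl⟩, rfl⟩
  obtain ⟨x, hx, hxt⟩ := hle h
  obtain rfl : x = wordPair E R t := hL hxt
  exact hx

theorem mem_adjoin_wordPairs (x : R.closedSpan p₀ × E.P p₀) :
    x ∈ StarAlgebra.adjoin ℂ (wordPairs E p₀ R) ↔ x ∈ Submodule.span ℂ (wordPairs E p₀ R) := by
  refine mem_adjoin_iff_mem_span ?_ ?_ ?_ x
  · exact ⟨_, .base 1, Prod.ext (Subtype.ext (map_one (R.π p₀)))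
      (Subtype.ext (map_one ((E.pathRep p₀).π p₀)))⟩
  · rintro _ ⟨_, t₁, rfl⟩ _ ⟨_, t₂, rfl⟩
    obtain ⟨_, t, h, h'⟩ := R.exists_comp_pair (E.pathRep p₀) t₁ t₂
    exact ⟨_, t, Prod.ext (Subtype.ext h) (Subtype.ext h')⟩
  · rintro _ ⟨_, t₁, rfl⟩
    obtain ⟨_, t, h, h'⟩ := R.exists_adj_pair (E.pathRep p₀) t₁
    exact ⟨_, t, Prod.ext (Subtype.ext h) (Subtype.ext h')⟩

theorem dense_span_words_closedSpan :
    Dense (Submodule.span ℂ {x | ∃ (w : EdgePath p₀ p₀) (t : G.Tuple w), R.word t = x} :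
      Set (R.closedSpan p₀)) := by
  refine dense_span_of_subset_closure _ _ ?_
  have : Subtype.val '' {x : R.closedSpan p₀ | ∃ (w : EdgePath p₀ p₀) (t : G.Tuple w),
      R.word t = x} = R.ops p₀ := by
    ext T
    constructor
    · rintro ⟨_, ⟨w, t, rfl⟩, rfl⟩
      exact ⟨w, t, rfl⟩
    · rintro ⟨w, t, rfl⟩
      exact ⟨_, ⟨w, t, rfl⟩, rfl⟩
  rw [this]
  exact subset_rfl

theorem dense_span_words_P :
    Dense (Submodule.span ℂ {x | ∃ (w : EdgePath p₀ p₀) (t : G.Tuple w), E.word t = x} :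
      Set (E.P p₀)) := by
  refine dense_span_of_subset_closure _ _ ?_
  have : Subtype.val '' {x : E.P p₀ | ∃ (w : EdgePath p₀ p₀) (t : G.Tuple w),
      E.word t = x} = (E.pathRep p₀).ops p₀ := by
    ext T
    constructor
    · rintro ⟨_, ⟨w, t, rfl⟩, rfl⟩
      exact ⟨w, t, rfl⟩
    · rintro ⟨w, t, rfl⟩
      exact ⟨_, ⟨w, t, rfl⟩, rfl⟩
  rw [this, Expectations.P, Rep.generated_eq_closedSpan]
  exact subset_rfl

theorem dense_fst_closure_adjoin_wordPairs :
    Dense (Prod.fst '' ((StarAlgebra.adjoin ℂ (wordPairs E p₀ R)).topologicalClosure :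
      Set (R.closedSpan p₀ × E.P p₀))) := by
  refine (dense_span_words_closedSpan R).mono ?_
  have hle : Submodule.span ℂ {x | ∃ (w : EdgePath p₀ p₀) (t : G.Tuple w), R.word t = x} ≤
      (Submodule.span ℂ (wordPairs E p₀ R)).map (LinearMap.fst ℂ _ _) := by
    refine Submodule.span_le.mpr ?_
    rintro _ ⟨w, t, rfl⟩
    exact ⟨wordPair E R t, Submodule.subset_span ⟨w, t, rfl⟩, rfl⟩
  intro x hx
  obtain ⟨y, hy, rfl⟩ := hle hx
  exact ⟨y, subset_closure ((mem_adjoin_wordPairs E R y).mpr hy), rfl⟩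

theorem dense_snd_closure_adjoin_wordPairs :
    Dense (Prod.snd '' ((StarAlgebra.adjoin ℂ (wordPairs E p₀ R)).topologicalClosure :
      Set (R.closedSpan p₀ × E.P p₀))) := by
  refine (dense_span_words_P E).mono ?_
  have hle : Submodule.span ℂ {x | ∃ (w : EdgePath p₀ p₀) (t : G.Tuple w), E.word t = x} ≤
      (Submodule.span ℂ (wordPairs E p₀ R)).map (LinearMap.snd ℂ _ _) := by
    refine Submodule.span_le.mpr ?_
    rintro _ ⟨w, t, rfl⟩
    exact ⟨wordPair E R t, Submodule.subset_span ⟨w, t, rfl⟩, rfl⟩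
  intro x hx
  obtain ⟨y, hy, rfl⟩ := hle hx
  exact ⟨y, subset_closure ((mem_adjoin_wordPairs E R y).mpr hy), rfl⟩

theorem wordPair_mem_closure {w : EdgePath p₀ p₀} (t : G.Tuple w) :
    wordPair E R t ∈ (StarAlgebra.adjoin ℂ (wordPairs E p₀ R)).topologicalClosure :=
  subset_closure (StarAlgebra.subset_adjoin ℂ _ ⟨w, t, rfl⟩)

/-! ### The two expectations agree -/

/-- The vacuum expectation `x ↦ ⟨Ω, x Ω⟩` on `P(p₀)`. -/
noncomputable def vacuumExpectation : E.P p₀ →L[ℂ] G.A p₀ :=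
  LinearMap.mkContinuous
    ((Adjointable.vectorFunctional (E.vacuum p₀)).toLinearMap.comp
      (E.P p₀).subtype.toAlgHom.toLinearMap)
    ‖Adjointable.vectorFunctional (A := G.A p₀) (E.vacuum p₀)‖
    fun x => (Adjointable.vectorFunctional (A := G.A p₀) (E.vacuum p₀)).le_opNorm x.1

theorem vacuumExpectation_apply (x : E.P p₀) :
    vacuumExpectation E x = inner (G.A p₀) (E.vacuum p₀) (x.1.toCLM (E.vacuum p₀)) := rfl

/-- The expectation `F` corresponds to the vacuum expectation on the algebra of pairs: both vanish
on reduced words of positive length. -/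
theorem expectation_eq_of_mem_closure {R : G.Rep (G.A p₀)}
    (F : ConditionalExpectation (R.vertexHom p₀).range)
    (hred : ∀ (w : EdgePath p₀ p₀) (t : G.Tuple w), 0 < w.length → E.Reduced t →
      F (R.word t) = 0) {x : R.closedSpan p₀ × E.P p₀}
    (hx : x ∈ (StarAlgebra.adjoin ℂ (wordPairs E p₀ R)).topologicalClosure) :
    (F x.1 : R.closedSpan p₀) = R.vertexHom p₀ (vacuumExpectation E x.2) := by
  have hF : Continuous fun y : R.closedSpan p₀ × E.P p₀ => (F y.1 : R.closedSpan p₀) :=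
    continuous_subtype_val.comp (F.continuous.comp continuous_fst)
  have hv : Continuous fun y : R.closedSpan p₀ × E.P p₀ =>
      R.vertexHom p₀ (vacuumExpectation E y.2) :=
    (AddMonoidHomClass.continuous_of_bound (R.vertexHom p₀) 1 fun a => by
      rw [one_mul]; exact NonUnitalStarAlgHom.norm_apply_le (R.vertexHom p₀) a).comp
        ((vacuumExpectation E).continuous.comp continuous_snd)
  refine closure_minimal (s := (StarAlgebra.adjoin ℂ (wordPairs E p₀ R) :
    Set (R.closedSpan p₀ × E.P p₀))) (fun y hy => ?_) (isClosed_eq hF hv) hx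
  have hy' := (mem_adjoin_wordPairs E R y).mp hy
  have hle : Submodule.span ℂ (wordPairs E p₀ R) ≤ Submodule.span ℂ
      {x | ∃ (w : EdgePath p₀ p₀) (t : G.Tuple w), E.Reduced t ∧ wordPair E R t = x} := by
    refine Submodule.span_le.mpr ?_
    rintro _ ⟨w, t, rfl⟩
    exact wordPair_mem_span_reduced E R t
  change (F y.1 : R.closedSpan p₀) = R.vertexHom p₀ (vacuumExpectation E y.2)
  have hy'' := hle hy'
  clear hy hy' hx
  induction hy'' using Submodule.span_induction with
  | mem y h =>
    obtain ⟨w, t, ht, rfl⟩ := h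
    cases t with
    | base a =>
      change (F (R.vertexHom p₀ a) : R.closedSpan p₀) =
        R.vertexHom p₀ (vacuumExpectation E (E.word (.base a)))
      rw [F.map_coe ⟨R.vertexHom p₀ a, a, rfl⟩, vacuumExpectation_apply]
      exact congrArg (R.vertexHom p₀) (E.vacuum_expectation_base a).symm
    | @cons _ r _ e w a t =>
      have hw : 0 < (EdgePath.cons e w).length := Nat.succ_pos _
      change (F (R.word (.cons a t)) : R.closedSpan p₀) =
        R.vertexHom p₀ (vacuumExpectation E (E.word (.cons a t)))
      rw [hred _ _ hw ht, vacuumExpectation_apply]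
      refine Eq.trans ?_ (congrArg (R.vertexHom p₀)
        (E.vacuum_expectation_eq_zero _ ht hw)).symm
      rw [map_zero]; rfl
  | zero => simp
  | add x y _ _ hx hy => simp [hx, hy]
  | smul c x _ hx => simp [hx]

/-- In a pair with first entry zero, the second entry kills all vectors `y Ω`, hence all elementary
tensors. -/
theorem snd_eq_zero_of_mem_closure {R : G.Rep (G.A p₀)} (hπ : Function.Injective (R.π p₀))
    (F : ConditionalExpectation (R.vertexHom p₀).range)
    (hred : ∀ (w : EdgePath p₀ p₀) (t : G.Tuple w), 0 < w.length → E.Reduced t →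
      F (R.word t) = 0) {b : E.P p₀}
    (hb : ((0, b) : R.closedSpan p₀ × E.P p₀) ∈
      (StarAlgebra.adjoin ℂ (wordPairs E p₀ R)).topologicalClosure) : b = 0 := by
  refine Subtype.ext (Adjointable.ext_vec fun x => ?_)
  obtain ⟨w, t, ht⟩ := x
  rw [← E.op_vacuum t ht]
  have hbt := mul_mem hb (wordPair_mem_closure E R t)
  have h := expectation_eq_of_mem_closure E F hred (mul_mem (star_mem hbt) hbt)
  have h0 : vacuumExpectation E (star (b * E.word t) * (b * E.word t)) = 0 := by
    refine hπ (congrArg Subtype.val ((h.symm.trans ?_).trans (map_zero (R.vertexHom p₀)).symm))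
    have e : (star (((0, b) : R.closedSpan p₀ × E.P p₀) * wordPair E R t) *
        (((0, b) : R.closedSpan p₀ × E.P p₀) * wordPair E R t)).1 = 0 := by
      change star (0 * R.word t) * (0 * R.word t) = 0
      rw [zero_mul, mul_zero]
    rw [e, map_zero]
    rfl
  have h' : inner (G.A p₀) (b.1.toCLM (((E.pathRep p₀).op t).toCLM (E.vacuum p₀)))
      (b.1.toCLM (((E.pathRep p₀).op t).toCLM (E.vacuum p₀))) = 0 :=
    ((b.1.comp ((E.pathRep p₀).op t)).inner_left _ _).trans h0
  have h'' := HilbertModule.norm_sq (A := G.A p₀)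
    (b.1.toCLM (((E.pathRep p₀).op t).toCLM (E.vacuum p₀)))
  rw [h', norm_zero, sq_eq_zero_iff, norm_eq_zero] at h''
  exact h''

/-- In a pair with second entry zero, the first entry is in the kernel of the GNS representation
of `F`. -/
theorem fst_eq_zero_of_mem_closure {R : G.Rep (G.A p₀)}
    (F : ConditionalExpectation (R.vertexHom p₀).range) (hF : F.GNSFaithful)
    (hred : ∀ (w : EdgePath p₀ p₀) (t : G.Tuple w), 0 < w.length → E.Reduced t →
      F (R.word t) = 0) {a : R.closedSpan p₀}
    (ha : ((a, 0) : R.closedSpan p₀ × E.P p₀) ∈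
      (StarAlgebra.adjoin ℂ (wordPairs E p₀ R)).topologicalClosure) : a = 0 := by
  refine hF a fun y => ?_
  have hc : IsClosed {y : R.closedSpan p₀ | F (star (a * y) * (a * y)) = 0} := by
    have hm : Continuous fun y : R.closedSpan p₀ => star (a * y) * (a * y) := by fun_prop
    exact isClosed_eq (F.continuous.comp hm) continuous_const
  refine hc.closure_subset_iff.mpr ?_ (dense_fst_closure_adjoin_wordPairs E R y)
  rintro _ ⟨z, hz, rfl⟩
  have haz := mul_mem ha hz
  have h := expectation_eq_of_mem_closure E F hred (mul_mem (star_mem haz) haz)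
  have e : (star (((a, 0) : R.closedSpan p₀ × E.P p₀) * z) *
      (((a, 0) : R.closedSpan p₀ × E.P p₀) * z)).2 = 0 := by
    change star (0 * z.2) * (0 * z.2) = 0
    rw [zero_mul, mul_zero]
  rw [e, map_zero, map_zero] at h
  exact Subtype.ext h

/-! ### The isomorphism -/

/-- The closure of the algebra of pairs is the graph of an isomorphism. -/
theorem exists_starAlgEquiv_word {R : G.Rep (G.A p₀)} (hπ : Function.Injective (R.π p₀))
    (F : ConditionalExpectation (R.vertexHom p₀).range) (hF : F.GNSFaithful)
    (hred : ∀ (w : EdgePath p₀ p₀) (t : G.Tuple w), 0 < w.length → E.Reduced t →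
      F (R.word t) = 0) :
    ∃ Φ : E.P p₀ ≃⋆ₐ[ℂ] R.closedSpan p₀,
      ∀ (w : EdgePath p₀ p₀) (t : G.Tuple w), Φ (E.word t) = R.word t := by
  obtain ⟨Φ, hΦ⟩ := exists_starAlgEquiv_of_graph
    (StarAlgebra.adjoin ℂ (wordPairs E p₀ R)).topologicalClosure
    (StarSubalgebra.isClosed_topologicalClosure _) (dense_fst_closure_adjoin_wordPairs E R)
    (dense_snd_closure_adjoin_wordPairs E R)
    (fun _ => snd_eq_zero_of_mem_closure E hπ F hred)
    (fun _ => fst_eq_zero_of_mem_closure E F hF hred)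
  exact ⟨Φ, fun w t => hΦ _ (wordPair_mem_closure E R t)⟩

/-- An isomorphism with the prescribed values on reduced words has the prescribed values on all
words. -/
theorem map_word_of_map_reduced {R : G.Rep (G.A p₀)} (Ψ : E.P p₀ ≃⋆ₐ[ℂ] R.closedSpan p₀)
    (h₁ : ∀ a : G.A p₀, Ψ (E.word (.base a)) = R.vertexHom p₀ a)
    (h₂ : ∀ (w : EdgePath p₀ p₀) (t : G.Tuple w), 0 < w.length → E.Reduced t →
      Ψ (E.word t) = R.word t) {w : EdgePath p₀ p₀} (t : G.Tuple w) :
    Ψ (E.word t) = R.word t := by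
  have hΨ : ∀ x ∈ Submodule.span ℂ
      {x | ∃ (w : EdgePath p₀ p₀) (t : G.Tuple w), E.Reduced t ∧ wordPair E R t = x},
      Ψ x.2 = x.1 := by
    intro x hx
    induction hx using Submodule.span_induction with
    | mem y h =>
      obtain ⟨w, t, ht, rfl⟩ := h
      cases t with
      | base a => exact h₁ a
      | cons a t => exact h₂ _ _ (Nat.succ_pos _) ht
    | zero => exact map_zero Ψ
    | add x y _ _ hx hy => rw [Prod.snd_add, map_add, hx, hy, Prod.fst_add]
    | smul c x _ hx => rw [Prod.smul_snd, map_smul, hx, Prod.smul_fst]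
  exact hΨ _ (wordPair_mem_span_reduced E R t)

/-- Isomorphisms onto the closed linear span are determined by their values on words. -/
theorem starAlgEquiv_ext_word {R : G.Rep (G.A p₀)} {Φ Ψ : E.P p₀ ≃⋆ₐ[ℂ] R.closedSpan p₀}
    (h : ∀ (w : EdgePath p₀ p₀) (t : G.Tuple w), Φ (E.word t) = Ψ (E.word t)) : Φ = Ψ := by
  have hcont : ∀ Θ : E.P p₀ ≃⋆ₐ[ℂ] R.closedSpan p₀, Continuous Θ := fun Θ =>
    (NonUnitalStarAlgHom.isometry Θ Θ.injective).continuous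
  refine DFunLike.coe_injective ?_
  refine (hcont Φ).ext_on (dense_span_words_P E) (hcont Ψ) fun x hx => ?_
  induction hx using Submodule.span_induction with
  | mem y h' =>
    obtain ⟨w, t, rfl⟩ := h'
    exact h w t
  | zero => rw [map_zero, map_zero]
  | add x y _ _ hx hy => rw [map_add, map_add, hx, hy]
  | smul c x _ hx => rw [map_smul, map_smul, hx]

end GraphOfCStarAlgebras
end GraphCStar

theorem mainTheorem7 {V : Type*} [Quiver V] [Quiver.HasInvolutiveReverse V]
    (G : GraphOfCStarAlgebras V) (E : G.Expectations) (p₀ : V)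
    (R : G.Rep (G.A p₀)) (hπ : ∀ p, Function.Injective (R.π p))
    (F : ConditionalExpectation (R.vertexHom p₀).range) (hF : F.GNSFaithful)
    (hred : ∀ (w : EdgePath p₀ p₀) (t : G.Tuple w), 0 < w.length → E.Reduced t →
      F (R.word t) = 0) :
    ∃! Φ : E.P p₀ ≃⋆ₐ[ℂ] R.closedSpan p₀,
      (∀ a : G.A p₀, Φ (E.word (.base a)) = R.vertexHom p₀ a) ∧
      ∀ (w : EdgePath p₀ p₀) (t : G.Tuple w), 0 < w.length → E.Reduced t →
        Φ (E.word t) = R.word t := by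
  obtain ⟨Φ, hΦw⟩ := exists_starAlgEquiv_word E (hπ p₀) F hF hred
  refine ⟨Φ, ⟨fun a => hΦw _ (.base a), fun w t _ _ => hΦw w t⟩, ?_⟩
  rintro Ψ ⟨hΨ₁, hΨ₂⟩
  exact starAlgEquiv_ext_word E fun w t =>
    (map_word_of_map_reduced E Ψ hΨ₁ hΨ₂ t).trans (hΦw w t).symm
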